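/- Let $K$ be a number field with ring of integers $\mathcal O_K$, let $\Gamma=\mathrm{GL}(2,\mathcal O_K)$, and for a nonzero ideal $\mathfrak n$ of $\mathcal O_K$ let $\Gamma_0(\mathfrak n)\subseteq\Gamma$ be the subgroup of matrices whose lower left entry lies in $\mathfrak n$, and $\psi(\mathfrak n)=N(\mathfrak n)\prod_{\mathfrak p\mid\mathfrak n}(1+N(\mathfrak p)^{-1})$. Put $\eta(\mathfrak b)=\prod_{\mathfrak p^e\|\mathfrak b}(1+N(\mathfrak p)+\dots+N(\mathfrak p)^e)$. Let $\widehat K=K\otimes_{\mathbb Q}\mathbb R$. A lattice is a finitely generated $\mathcal O_K$-submodule $L\subset\widehat K^2$ (row vectors) with $\widehat KL=\widehat K^2$ and $\dim_K KL=2$. For lattices $M\subseteq L$ the index ideal is $[L:M]=\mathfrak c_1\mathfrak c_2$, where $L/M\cong\mathcal O_K/\mathfrak c_1\oplus\mathcal O_K/\mathfrak c_2$ with $\mathfrak c_1\mid\mathfrak c_2$. On the $\mathbb Q$-vector space with basis the set of lattices let $$\widetilde T_{\mathfrak b}(L)=N(\mathfrak b)\sum_{M\subseteq L,\ [L:M]=\mathfrak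 b}M,\qquad \widetilde T_{\mathfrak a,\mathfrak a}(L)=N(\mathfrak a)^2\,\mathfrak aL .$$ For ideals $\mathfrak c,\mathfrak d$, a $(\mathfrak c,\mathfrak d)$-matrix is a $2\times2$ matrix $B$ over $\mathcal O_K$ with $(\mathcal O_K\oplus\mathcal O_K)B=\mathfrak c\oplus\mathfrak d$. **Lemma.** Let $\mathfrak a,\mathfrak b$ be nonzero ideals of $\mathcal O_K$ with $\mathfrak a^2\mathfrak b=\langle\beta\rangle$ principal. Then: 1. $\eta(\mathfrak b)=\sum_{\mathfrak b=\mathfrak b_1\mathfrak b_2^2}\psi(\mathfrak b_1)$, the sum being over all factorizations of $\mathfrak b$ of the form $\mathfrak b=\mathfrak b_1\mathfrak b_2^2$. 2. For each factorization $\mathfrak b=\mathfrak b_1\mathfrak b_2^2$ there exist an $(\mathfrak a\mathfrak b_1\mathfrak b_2,\mathfrak a\mathfrak b_2)$-matrix $B$ with $\det B=\beta$, and a complete set $S$ of representatives, all of determinant $1$, of the right cosets $\Gamma_0(\mathfrak b_1)\gamma$ in $\Gamma$. 3. Fix any such $B=B_{\mathfrak b_1,\mathfrak b_2}$ and $S=S_{\mathfrak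 b_1,\mathfrak b_2}$ for each factorization. Then $S_{\mathfrak b_1,\mathfrak b_2}$ has exactly $\psi(\mathfrak b_1)$ elements. The matrices $B_{\mathfrak b_1,\mathfrak b_2}C$, with $(\mathfrak b_1,\mathfrak b_2)$ running over all factorizations and $C$ over $S_{\mathfrak b_1,\mathfrak b_2}$, form a set of exactly $\eta(\mathfrak b)$ matrices $g_1,\dots,g_{\eta(\mathfrak b)}$, all of determinant $\beta$, such that $$\widetilde T_{\mathfrak a,\mathfrak a}\widetilde T_{\mathfrak b}(\mathcal O_K\oplus\mathcal O_K)=N(\mathfrak a)^2N(\mathfrak b)\sum_{i=1}^{\eta(\mathfrak b)}(\mathcal O_K\oplus\mathcal O_K)g_i .$$ Moreover right multiplication by $\Gamma$ permutes the cosets $\Gamma g_i$: for every $\gamma\in\Gamma$ there is a permutation $\sigma$ of $\{1,\dots,\eta(\mathfrak b)\}$ with $\Gamma g_i\gamma=\Gamma g_{\sigma(i)}$ for all $i$. -/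

import Mathlib

open NumberField Matrix
open scoped TensorProduct

noncomputable section

namespace HeckeLattice

variable (K : Type*) [Field K] [NumberField K]

/-- The real algebra `K ⊗ ℝ ≅ ℝ^{r₁} ⊕ ℂ^{r₂}`, containing `K`. -/
def KHat : Type _ := K ⊗[ℚ] ℝ

instance : CommRing (KHat K) := inferInstanceAs (CommRing (K ⊗[ℚ] ℝ))

instance : Nontrivial (KHat K) := inferInstanceAs (Nontrivial (K ⊗[ℚ] ℝ))

/-- The embedding `x ↦ x ⊗ 1` of `K` in `K ⊗ ℝ`. -/
instance : Algebra K (KHat K) := inferInstanceAs (Algebra K (K ⊗[ℚ] ℝ))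

instance : Algebra (𝓞 K) (KHat K) :=
  ((algebraMap K (KHat K)).comp (algebraMap (𝓞 K) K)).toAlgebra

instance : IsScalarTower (𝓞 K) K (KHat K) := IsScalarTower.of_algebraMap_eq' rfl

/-- Row vectors of length two over `K ⊗ ℝ`. -/
abbrev RowSpace : Type _ := Fin 2 → KHat K

/-- An `𝓞 K`-lattice in `(K ⊗ ℝ)²`: a finitely generated `𝓞 K`-submodule `L` which spans
`(K ⊗ ℝ)²` over `K ⊗ ℝ` and whose `K`-span has dimension two. -/
@[ext]
structure OLattice where
  carrier : Submodule (𝓞 K) (RowSpace K)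
  fg : carrier.FG
  span_hat : Submodule.span (KHat K) (carrier : Set (RowSpace K)) = ⊤
  finrank_span : Module.finrank K (Submodule.span K (carrier : Set (RowSpace K))) = 2

variable {K}

/-- Right multiplication of row vectors by an invertible matrix. -/
def rowEquiv (U : GL (Fin 2) (KHat K)) : RowSpace K ≃ₗ[KHat K] RowSpace K :=
  LinearEquiv.ofLinearMap (U : Matrix (Fin 2) (Fin 2) (KHat K)).vecMulLinear
    ((U⁻¹ : GL (Fin 2) (KHat K)) : Matrix (Fin 2) (Fin 2) (KHat K)).vecMulLinear
    (by
      ext1 i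
      ext1
      simp only [LinearMap.comp_apply, Matrix.vecMulLinear_apply, Matrix.vecMul_vecMul,
        Units.inv_mul, Matrix.vecMul_one, LinearMap.id_apply])
    (by
      ext1 i
      ext1
      simp only [LinearMap.comp_apply, Matrix.vecMulLinear_apply, Matrix.vecMul_vecMul,
        Units.mul_inv, Matrix.vecMul_one, LinearMap.id_apply])

/-- The lattice `L U`, for `U` in `GL(2, K ⊗ ℝ)`. -/
def OLattice.mulGL (L : OLattice K) (U : GL (Fin 2) (KHat K)) : OLattice K where
  carrier := L.carrier.map ((rowEquiv U).restrictScalars (𝓞 K)).toLinearMap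
  fg := L.fg.map _
  span_hat := by
    have h := Submodule.map_span (rowEquiv U).toLinearMap (L.carrier : Set (RowSpace K))
    rw [L.span_hat, Submodule.map_top, LinearEquiv.range] at h
    rw [Submodule.map_coe]
    exact h.symm
  finrank_span := by
    have h := Submodule.map_span ((rowEquiv U).restrictScalars K).toLinearMap
      (L.carrier : Set (RowSpace K))
    rw [Submodule.map_coe]
    refine Eq.trans ?_ L.finrank_span
    refine Eq.trans ?_ (LinearEquiv.finrank_map_eq ((rowEquiv U).restrictScalars K) _)
    exact congrArg (fun S : Submodule K (RowSpace K) => Module.finrank K S) h.symm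

/-- A matrix over `𝓞 K` with nonzero determinant, as an element of `GL(2, K ⊗ ℝ)`. -/
def toGLHat (g : Matrix (Fin 2) (Fin 2) (𝓞 K)) (hg : g.det ≠ 0) : GL (Fin 2) (KHat K) :=
  Matrix.GeneralLinearGroup.map (algebraMap K (KHat K))
    (Matrix.GeneralLinearGroup.mkOfDetNeZero (g.map (algebraMap (𝓞 K) K)) (by
      have h := RingHom.map_det (algebraMap (𝓞 K) K) g
      rw [RingHom.mapMatrix_apply] at h
      rw [← h]
      exact (map_ne_zero_iff _ (FaithfulSMul.algebraMap_injective (𝓞 K) K)).mpr hg))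

/-- The lattice `L g`, for a matrix `g` over `𝓞 K` with nonzero determinant. -/
def OLattice.mulMat (L : OLattice K) (g : Matrix (Fin 2) (Fin 2) (𝓞 K)) (hg : g.det ≠ 0) :
    OLattice K :=
  L.mulGL (toGLHat g hg)

variable (K) in
/-- The lattice `𝓞 K ⊕ 𝓞 K`. -/
def stdLattice : OLattice K where
  carrier := LinearMap.range ((Algebra.linearMap (𝓞 K) (KHat K)).compLeft (Fin 2))
  fg := by
    rw [LinearMap.range_eq_map]
    exact Module.Finite.fg_top.map _
  span_hat := by
    rw [eq_top_iff, ← (Pi.basisFun (KHat K) (Fin 2)).span_eq, Submodule.span_le]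
    rintro _ ⟨i, rfl⟩
    refine Submodule.subset_span ⟨Pi.single i 1, ?_⟩
    ext j
    by_cases h : j = i
    · subst h; simp
    · simp [Pi.single_eq_of_ne h]
  finrank_span := by
    have h : Submodule.span K (LinearMap.range
          ((Algebra.linearMap (𝓞 K) (KHat K)).compLeft (Fin 2)) : Set (RowSpace K)) =
        LinearMap.range ((Algebra.linearMap K (KHat K)).compLeft (Fin 2)) := by
      apply le_antisymm
      · rw [Submodule.span_le]
        rintro _ ⟨v, rfl⟩
        refine ⟨fun i => algebraMap (𝓞 K) K (v i), ?_⟩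
        ext i
        simp [← IsScalarTower.algebraMap_apply]
      · rw [LinearMap.range_eq_map, ← (Pi.basisFun K (Fin 2)).span_eq, Submodule.map_span,
          Submodule.span_le]
        rintro _ ⟨_, ⟨i, rfl⟩, rfl⟩
        refine Submodule.subset_span ⟨Pi.single i 1, ?_⟩
        ext j
        by_cases h : j = i
        · subst h; simp
        · simp [Pi.single_eq_of_ne h]
    rw [h, LinearMap.finrank_range_of_inj, Module.finrank_fin_fun]
    intro v w hvw
    ext i
    exact FaithfulSMul.algebraMap_injective K (KHat K) (congrFun hvw i)

/-- The lattice `𝔞 L` of finite sums of products, for a nonzero ideal `𝔞`. -/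
def OLattice.idealMul (a : Ideal (𝓞 K)) (ha : a ≠ ⊥) (L : OLattice K) : OLattice K where
  carrier := a • L.carrier
  fg := Submodule.FG.smul (IsNoetherian.noetherian a) L.fg
  span_hat := by
    obtain ⟨x, hx, hx0⟩ := Submodule.exists_mem_ne_zero_of_ne_bot ha
    have hx' : algebraMap (𝓞 K) K x ≠ 0 :=
      (map_ne_zero_iff _ (FaithfulSMul.algebraMap_injective (𝓞 K) K)).mpr hx0
    rw [eq_top_iff, ← L.span_hat, Submodule.span_le]
    intro v hv
    have h1 : x • v ∈ Submodule.span (KHat K) ((a • L.carrier : Submodule _ _) : Set (RowSpace K)) :=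
      Submodule.subset_span (Submodule.smul_mem_smul hx hv)
    have h2 := Submodule.smul_mem _ (algebraMap K (KHat K) (algebraMap (𝓞 K) K x)⁻¹) h1
    rw [algebraMap_smul, ← algebraMap_smul K x v, smul_smul, inv_mul_cancel₀ hx', one_smul] at h2
    exact h2
  finrank_span := by
    obtain ⟨x, hx, hx0⟩ := Submodule.exists_mem_ne_zero_of_ne_bot ha
    have hx' : algebraMap (𝓞 K) K x ≠ 0 :=
      (map_ne_zero_iff _ (FaithfulSMul.algebraMap_injective (𝓞 K) K)).mpr hx0
    have h : Submodule.span K ((a • L.carrier : Submodule _ _) : Set (RowSpace K)) =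
        Submodule.span K (L.carrier : Set (RowSpace K)) := by
      apply le_antisymm
      · exact Submodule.span_mono (fun v hv => Submodule.smul_le_right hv)
      · rw [Submodule.span_le]
        intro v hv
        have h1 : x • v ∈ Submodule.span K ((a • L.carrier : Submodule _ _) : Set (RowSpace K)) :=
          Submodule.subset_span (Submodule.smul_mem_smul hx hv)
        have h2 := Submodule.smul_mem _ (algebraMap (𝓞 K) K x)⁻¹ h1
        rw [← algebraMap_smul K x v, smul_smul, inv_mul_cancel₀ hx', one_smul] at h2
        exact h2
    rw [h]
    exact L.finrank_span

/-- `M ⊆ L` with index ideal `[L : M] = 𝔠`: the quotient `L / M` is isomorphic to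
`𝓞 K / 𝔠₁ ⊕ 𝓞 K / 𝔠₂` with `𝔠₁ ∣ 𝔠₂` and `𝔠 = 𝔠₁ 𝔠₂`. -/
def HasIndexIdeal (L M : OLattice K) (c : Ideal (𝓞 K)) : Prop :=
  M.carrier ≤ L.carrier ∧
    ∃ c₁ c₂ : Ideal (𝓞 K), c₁ ∣ c₂ ∧ c₁ * c₂ = c ∧
      Nonempty ((L.carrier ⧸ M.carrier.submoduleOf L.carrier) ≃ₗ[𝓞 K]
        ((𝓞 K ⧸ c₁) × (𝓞 K ⧸ c₂)))

/-- The operator `T̃_𝔟` on formal linear combinations of lattices: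
`L ↦ N(𝔟) ∑ M`, over all sublattices `M` of `L` of index `𝔟`. -/
def dualT (b : Ideal (𝓞 K)) : (OLattice K →₀ ℚ) →ₗ[ℚ] (OLattice K →₀ ℚ) :=
  Finsupp.linearCombination ℚ fun L : OLattice K =>
    (Ideal.absNorm b : ℚ) •
      ∑ᶠ M ∈ {M : OLattice K | HasIndexIdeal L M b}, Finsupp.single M (1 : ℚ)

/-- The operator `T̃_{𝔞,𝔞}` on formal linear combinations of lattices: `L ↦ N(𝔞)² 𝔞L`. -/
def dualTT (a : Ideal (𝓞 K)) (ha : a ≠ ⊥) : (OLattice K →₀ ℚ) →ₗ[ℚ] (OLattice K →₀ ℚ) :=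
  Finsupp.linearCombination ℚ fun L : OLattice K =>
    (Ideal.absNorm a : ℚ) ^ 2 • Finsupp.single (L.idealMul a ha) (1 : ℚ)

/-- `M` is an `(𝔞, 𝔟)`-matrix: `(𝓞 K ⊕ 𝓞 K) M = 𝔞 ⊕ 𝔟`. -/
def IsIdealPairMatrix (a b : Ideal (𝓞 K)) (M : Matrix (Fin 2) (Fin 2) (𝓞 K)) : Prop :=
  Set.range (fun v : Fin 2 → 𝓞 K => v ᵥ* M) = {w | w 0 ∈ a ∧ w 1 ∈ b}

/-- `Γ₀(𝔫)` inside `Γ = GL(2, 𝓞 K)`. -/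
def Gamma0 (n : Ideal (𝓞 K)) : Subgroup (GL (Fin 2) (𝓞 K)) where
  carrier := {γ | γ 1 0 ∈ n}
  one_mem' := by simp
  mul_mem' := by
    intro x y hx hy
    simp only [Set.mem_ofPred_eq] at hx hy ⊢
    rw [Matrix.GeneralLinearGroup.coe_mul, Matrix.mul_apply, Fin.sum_univ_two]
    exact n.add_mem (n.mul_mem_right _ hx) (n.mul_mem_left _ hy)
  inv_mem' := by
    intro x hx
    simp only [Set.mem_ofPred_eq] at hx ⊢
    rw [Matrix.coe_units_inv, Matrix.inv_def, Matrix.adjugate_fin_two]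
    have h := n.mul_mem_left (Ring.inverse (x : Matrix (Fin 2) (Fin 2) (𝓞 K)).det) (n.neg_mem hx)
    simpa [-mul_neg] using h

open scoped Classical in
/-- `ψ(𝔫) = N(𝔫) ∏_{𝔭 ∣ 𝔫} (1 + N(𝔭)⁻¹)`. -/
def psi (n : Ideal (𝓞 K)) : ℚ :=
  (Ideal.absNorm n : ℚ) *
    ∏ p ∈ (UniqueFactorizationMonoid.normalizedFactors n).toFinset,
      (1 + (Ideal.absNorm p : ℚ)⁻¹)

open scoped Classical in
/-- `η(𝔟) = ∏_{𝔭 ∣ 𝔟} (1 + N(𝔭) + ⋯ + N(𝔭)^e)`, with `e` the exponent of `𝔭` in `𝔟`. -/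
def eta (b : Ideal (𝓞 K)) : ℕ :=
  ∏ p ∈ (UniqueFactorizationMonoid.normalizedFactors b).toFinset,
    ∑ k ∈ Finset.range ((UniqueFactorizationMonoid.normalizedFactors b).count p + 1),
      Ideal.absNorm p ^ k

/-- The factorizations `𝔟 = 𝔟₁ 𝔟₂²`, as pairs `(𝔟₁, 𝔟₂)`. -/
def factorizations (b : Ideal (𝓞 K)) : Set (Ideal (𝓞 K) × Ideal (𝓞 K)) :=
  {f | f.1 * f.2 ^ 2 = b}

/-- `S` is a complete irredundant set of representatives, all of determinant one, of the right
cosets `Γ₀(𝔫) γ` in `Γ`. -/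
def IsUnimodularReps (n : Ideal (𝓞 K)) (S : Set (GL (Fin 2) (𝓞 K))) : Prop :=
  (∀ C ∈ S, (C : Matrix (Fin 2) (Fin 2) (𝓞 K)).det = 1) ∧
    Subgroup.IsComplement (Gamma0 n : Set (GL (Fin 2) (𝓞 K))) S

theorem generator_ne_zero {a b : Ideal (𝓞 K)} {β : 𝓞 K} (ha : a ≠ ⊥) (hb : b ≠ ⊥)
    (h : a ^ 2 * b = Ideal.span {β}) : β ≠ 0 := by
  rintro rfl
  have h0 : a ^ 2 * b = 0 := by simpa using h
  rcases mul_eq_zero.mp h0 with h1 | h1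
  · exact ha (pow_eq_zero_iff (two_ne_zero)|>.mp h1)
  · exact hb h1

end HeckeLattice

end

/-! Everything is moved into `R²`, `R = 𝓞 K`, where a matrix `g` of nonzero determinant is known, up
to left multiplication by `Γ`, by its row module `R² g` (`exists_mul_eq_of_rowMap_top_eq`).

By elementary divisors (`exists_rowMap_pairSubmodule_eq`), a submodule with quotient `R/𝔠₁ ⊕ R/𝔠₂`,
`𝔠₁ ∣ 𝔠₂`, is `(𝔠₂ ⊕ 𝔠₁) C` with `C` invertible. With `𝔟₂ = 𝔠₁` and `𝔟₁ = 𝔠₂/𝔠₁`, the sublattices of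
index `𝔟` are therefore the modules `(𝔟₁𝔟₂ ⊕ 𝔟₂) C` with `𝔟 = 𝔟₁𝔟₂²`. The annihilator of the
quotient recovers the pair `(𝔟₁, 𝔟₂)`, and the stabilizer of `𝔟₁𝔟₂ ⊕ 𝔟₂` is `Γ₀(𝔟₁)`. So these
sublattices correspond exactly to a factorization together with a coset of `Γ₀(𝔟₁)`. After scaling
by `𝔞`, the product of the two summands is `𝔞²𝔟 = (β)`, so the module is free: it is `R² B` with
`det B = β`, and the matrices `BC` represent all the scaled lattices without repetition.

For the count, `[Γ : Γ₀(𝔫)] = ψ(𝔫)` follows by adding one prime at a time to `𝔫`, and `∑ ψ(𝔟₁) =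
η(𝔟)` follows by multiplicativity from the prime power case. Finally `Γ` acts on the right on this
finite set of lattices, hence permutes the cosets `Γ gᵢ`. -/

noncomputable section

namespace HeckeLattice

/-! ### Row modules over a commutative ring. -/

section Rows

variable {R : Type*} [CommRing R]

/-- The submodule `𝔠 ⊕ 𝔡` of `R²`. -/
def pairSubmodule (c d : Ideal R) : Submodule R (Fin 2 → R) where
  carrier := {w | w 0 ∈ c ∧ w 1 ∈ d}
  zero_mem' := ⟨c.zero_mem, d.zero_mem⟩
  add_mem' := fun hx hy => ⟨c.add_mem hx.1 hy.1, d.add_mem hx.2 hy.2⟩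
  smul_mem' := fun r _ hx => ⟨c.mul_mem_left r hx.1, d.mul_mem_left r hx.2⟩

theorem mem_pairSubmodule {c d : Ideal R} {w : Fin 2 → R} :
    w ∈ pairSubmodule c d ↔ w 0 ∈ c ∧ w 1 ∈ d := Iff.rfl

/-- The image `N M` of a submodule of row vectors under right multiplication by a matrix. -/
def rowMap (N : Submodule R (Fin 2 → R)) (M : Matrix (Fin 2) (Fin 2) R) :
    Submodule R (Fin 2 → R) :=
  N.map M.vecMulLinear

theorem rowMap_mul (N : Submodule R (Fin 2 → R)) (M M' : Matrix (Fin 2) (Fin 2) R) :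
    rowMap N (M * M') = rowMap (rowMap N M) M' := by
  rw [rowMap, rowMap, rowMap, ← Submodule.map_comp]
  congr 1
  ext1 i
  ext1
  simp [← Matrix.vecMul_vecMul]

theorem rowMap_one (N : Submodule R (Fin 2 → R)) : rowMap N 1 = N := by
  have : (1 : Matrix (Fin 2) (Fin 2) R).vecMulLinear = LinearMap.id := by
    ext1 i; ext1; simp
  rw [rowMap, this, Submodule.map_id]

theorem rowMap_smul (a : Ideal R) (N : Submodule R (Fin 2 → R)) (M : Matrix (Fin 2) (Fin 2) R) :
    rowMap (a • N) M = a • rowMap N M :=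
  Submodule.map_smul'' a N _

theorem mem_rowMap_iff {N : Submodule R (Fin 2 → R)} {C : GL (Fin 2) R} {v : Fin 2 → R} :
    v ∈ rowMap N C ↔ v ᵥ* ((C⁻¹ : GL (Fin 2) R) : Matrix (Fin 2) (Fin 2) R) ∈ N := by
  constructor
  · rintro ⟨w, hw, rfl⟩
    simpa [Matrix.vecMul_vecMul] using hw
  · intro h
    exact ⟨_, h, by rw [Matrix.vecMulLinear_apply, Matrix.vecMul_vecMul, Units.inv_mul,
      Matrix.vecMul_one]⟩

theorem rowMap_eq_iff {N N' : Submodule R (Fin 2 → R)} {C C' : GL (Fin 2) R} :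
    rowMap N C = rowMap N' C' ↔ rowMap N ((C * C'⁻¹ : GL (Fin 2) R) : Matrix _ _ R) = N' := by
  constructor
  · intro h
    rw [Units.val_mul, rowMap_mul, h, ← rowMap_mul, Units.mul_inv, rowMap_one]
  · intro h
    rw [← h, ← rowMap_mul, ← Units.val_mul, inv_mul_cancel_right]

theorem smul_pairSubmodule (a c d : Ideal R) :
    a • pairSubmodule c d = pairSubmodule (a * c) (a * d) := by
  apply le_antisymm
  · rw [Submodule.smul_le]
    intro r hr w hw
    exact ⟨Ideal.mul_mem_mul hr hw.1, Ideal.mul_mem_mul hr hw.2⟩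
  · have h0 : ∀ x ∈ a * c, (![x, 0] : Fin 2 → R) ∈ a • pairSubmodule c d := by
      intro x hx
      refine Submodule.mul_induction_on hx (fun m hm n hn => ?_) (fun x y hx hy => ?_)
      · have : (![m * n, 0] : Fin 2 → R) = m • ![n, 0] := by ext i; fin_cases i <;> simp
        rw [this]
        exact Submodule.smul_mem_smul hm ⟨hn, d.zero_mem⟩
      · have : (![x + y, 0] : Fin 2 → R) = ![x, 0] + ![y, 0] := by ext i; fin_cases i <;> simp
        rw [this]
        exact add_mem hx hy
    have h1 : ∀ x ∈ a * d, (![0, x] : Fin 2 → R) ∈ a • pairSubmodule c d := by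
      intro x hx
      refine Submodule.mul_induction_on hx (fun m hm n hn => ?_) (fun x y hx hy => ?_)
      · have : (![0, m * n] : Fin 2 → R) = m • ![0, n] := by ext i; fin_cases i <;> simp
        rw [this]
        exact Submodule.smul_mem_smul hm ⟨c.zero_mem, hn⟩
      · have : (![0, x + y] : Fin 2 → R) = ![0, x] + ![0, y] := by ext i; fin_cases i <;> simp
        rw [this]
        exact add_mem hx hy
    intro w hw
    have : w = ![w 0, 0] + ![0, w 1] := by ext i; fin_cases i <;> simp
    rw [this]
    exact add_mem (h0 _ hw.1) (h1 _ hw.2)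

/-- `𝔠` is recovered from `(𝔠 ⊕ 𝔡) C`, for `𝔠 ⊆ 𝔡`, as the annihilator of the quotient of `R²`. -/
theorem mem_iff_smul_mem_rowMap {c d : Ideal R} (h : c ≤ d) (C : GL (Fin 2) R) (r : R) :
    r ∈ c ↔ ∀ v, r • v ∈ rowMap (pairSubmodule c d) C := by
  constructor
  · intro hr v
    rw [mem_rowMap_iff, Matrix.smul_vecMul]
    exact ⟨c.mul_mem_right _ hr, d.mul_mem_right _ (h hr)⟩
  · intro hr
    have := hr ((![1, 0] : Fin 2 → R) ᵥ* (C : Matrix (Fin 2) (Fin 2) R))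
    rw [mem_rowMap_iff, Matrix.smul_vecMul, Matrix.vecMul_vecMul, Units.mul_inv,
      Matrix.vecMul_one] at this
    simpa using this.1

/-- The quotient of `R²` by `(𝔠₂ ⊕ 𝔠₁) C` is `R/𝔠₁ ⊕ R/𝔠₂`. -/
theorem nonempty_quotient_rowMap_equiv (c₁ c₂ : Ideal R) (C : GL (Fin 2) R) :
    Nonempty (((Fin 2 → R) ⧸ rowMap (pairSubmodule c₂ c₁) C) ≃ₗ[R] ((R ⧸ c₁) × (R ⧸ c₂))) := by
  set F : (Fin 2 → R) →ₗ[R] ((R ⧸ c₁) × (R ⧸ c₂)) :=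
    (((c₁.mkQ ∘ₗ LinearMap.proj 1).prod (c₂.mkQ ∘ₗ LinearMap.proj 0)) ∘ₗ
      ((C⁻¹ : GL (Fin 2) R) : Matrix (Fin 2) (Fin 2) R).vecMulLinear)
  have hF : Function.Surjective F := by
    rintro ⟨x, y⟩
    obtain ⟨x, rfl⟩ := c₁.mkQ_surjective x
    obtain ⟨y, rfl⟩ := c₂.mkQ_surjective y
    refine ⟨(![y, x] : Fin 2 → R) ᵥ* (C : Matrix (Fin 2) (Fin 2) R), ?_⟩
    simp only [F, LinearMap.comp_apply, Matrix.vecMulLinear_apply, Matrix.vecMul_vecMul,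
      Units.mul_inv, Matrix.vecMul_one]
    rfl
  have hk : rowMap (pairSubmodule c₂ c₁) C = LinearMap.ker F := by
    ext v
    rw [mem_rowMap_iff, LinearMap.mem_ker, mem_pairSubmodule]
    rw [Prod.ext_iff, and_comm]
    exact and_congr (Submodule.Quotient.mk_eq_zero c₁).symm (Submodule.Quotient.mk_eq_zero c₂).symm
  exact ⟨(Submodule.quotEquivOfEq _ _ hk).trans (F.quotKerEquivOfSurjective hF)⟩

/-- Two matrices of nonzero determinant with the same row module are left associated. -/
theorem exists_mul_eq_of_rowMap_top_eq [IsDomain R] {g g' : Matrix (Fin 2) (Fin 2) R} (hg : g.det ≠ 0)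
    (h : rowMap ⊤ g = rowMap ⊤ g') : ∃ δ : GL (Fin 2) R, (δ : Matrix (Fin 2) (Fin 2) R) * g = g' := by
  have key : ∀ g g' : Matrix (Fin 2) (Fin 2) R, rowMap ⊤ g' ≤ rowMap ⊤ g →
      ∃ δ : Matrix (Fin 2) (Fin 2) R, δ * g = g' := by
    intro g g' hle
    have h1 : ∀ i, ∃ v : Fin 2 → R, v ᵥ* g = g' i := by
      intro i
      have : g' i ∈ rowMap ⊤ g' := ⟨Pi.single i 1, Submodule.mem_top, by
        rw [Matrix.vecMulLinear_apply, Matrix.single_one_vecMul]; rfl⟩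
      obtain ⟨v, -, hv⟩ := hle this
      exact ⟨v, hv⟩
    choose v hv using h1
    refine ⟨Matrix.of v, ?_⟩
    ext i j
    rw [← hv i]
    rfl
  obtain ⟨δ, hδ⟩ := key g g' h.ge
  obtain ⟨δ', hδ'⟩ := key g' g h.le
  -- `δ'δ - 1` annihilates `g` from the left; multiplying by the adjugate turns `g` into the nonzero
  -- scalar `det g`, which cancels.
  have h1 : δ' * δ = 1 := by
    have h2 : (δ' * δ - 1) * g = 0 := by
      rw [sub_mul, mul_assoc, hδ, hδ', one_mul, sub_self]
    have h3 : (δ' * δ - 1) * g * g.adjugate = 0 := by rw [h2, zero_mul]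
    rw [mul_assoc, Matrix.mul_adjugate, Matrix.mul_smul, mul_one] at h3
    exact sub_eq_zero.mp ((smul_eq_zero.mp h3).resolve_left hg)
  exact ⟨⟨δ, δ', mul_eq_one_comm.mp h1, h1⟩, hδ⟩

/-! ### Elementary divisors and stabilizers over a Dedekind domain. -/

variable [IsDedekindDomain R]

/-- Over a Dedekind domain, a pair which is unimodular modulo a nonzero ideal lifts to a
unimodular pair. -/
theorem exists_isCoprime_lift {n : Ideal R} (hn : n ≠ ⊥) (r s : R)
    (h : Ideal.span {r} ⊔ Ideal.span {s} ⊔ n = ⊤) :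
    ∃ r' s' : R, r' - r ∈ n ∧ s' - s ∈ n ∧ IsCoprime r' s' := by
  classical
  -- A nonzero `s'` lies in only finitely many primes, the set `P`; only these can obstruct
  -- coprimality.
  obtain ⟨s', hs', hs0⟩ : ∃ s', s' - s ∈ n ∧ s' ≠ 0 := by
    by_cases hs : s = 0
    · obtain ⟨x, hx, hx0⟩ := Submodule.exists_mem_ne_zero_of_ne_bot hn
      exact ⟨x, by simpa [hs] using hx, hx0⟩
    · exact ⟨s, by simp, hs⟩
  have hfin : {v : IsDedekindDomain.HeightOneSpectrum R | v.asIdeal ∣ Ideal.span {s'}}.Finite :=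
    Ideal.finite_factors (by simpa using hs0)
  set P := hfin.toFinset
  have hP : ∀ v : IsDedekindDomain.HeightOneSpectrum R, v ∈ P ↔ s' ∈ v.asIdeal := by
    intro v
    simp [P, Ideal.dvd_span_singleton]
  -- The correction `t` to `r` is sought in `J`, outside every prime of `P` containing `r`. Then at
  -- each prime of `P` exactly one of `r`, `t` is in the prime, so `r + t` is not.
  set J : Ideal R := n * ∏ v ∈ P.filter (fun v => r ∉ v.asIdeal), v.asIdeal
  have hJn : J ≤ n := Ideal.mul_le_left
  have hJ : ¬ ((J : Set R) ⊆ ⋃ v ∈ ((P.filter fun v => r ∈ v.asIdeal : Finset _) :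
      Set (IsDedekindDomain.HeightOneSpectrum R)), (v.asIdeal : Set R)) := by
    intro hsub
    -- Prime avoidance lets two members of the family be arbitrary ideals, so two indices must be
    -- named; `v₀` serves as both.
    rcases P.eq_empty_or_nonempty with hP0 | ⟨v₀, -⟩
    · have := hsub J.zero_mem
      simp [hP0] at this
    rw [Ideal.subset_union_prime v₀ v₀ (fun i _ _ _ => i.isPrime)] at hsub
    obtain ⟨v, hv, hle⟩ := hsub
    rw [Finset.mem_filter, hP] at hv
    rcases v.isPrime.mul_le.mp hle with h1 | h1
    · have hs : s ∈ v.asIdeal := by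
        have := v.asIdeal.sub_mem hv.1 (h1 hs')
        simpa using this
      apply v.isPrime.ne_top
      rw [eq_top_iff, ← h]
      refine sup_le (sup_le ?_ ?_) h1 <;> rw [Ideal.span_singleton_le_iff_mem]
      exacts [hv.2, hs]
    · obtain ⟨w, hw, hwv⟩ := (Ideal.IsPrime.prod_le v.isPrime).mp h1
      rw [Finset.mem_filter] at hw
      have : w.asIdeal = v.asIdeal := w.isMaximal.eq_of_le v.isPrime.ne_top hwv
      exact hw.2 (this ▸ hv.2)
  obtain ⟨t, htJ, ht⟩ := Set.not_subset.mp hJ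
  refine ⟨r + t, s', by simpa using hJn htJ, hs', ?_⟩
  rw [← Ideal.isCoprime_span_singleton_iff, Ideal.isCoprime_iff_sup_eq]
  by_contra hne
  obtain ⟨m, hm, hle⟩ := Ideal.exists_le_maximal _ hne
  have hsm : s' ∈ m := hle (Ideal.mem_sup_right (Ideal.mem_span_singleton_self _))
  have hrm : r + t ∈ m := hle (Ideal.mem_sup_left (Ideal.mem_span_singleton_self _))
  have hm0 : m ≠ ⊥ := by
    rintro rfl
    exact hs0 (by simpa using hsm)
  set v : IsDedekindDomain.HeightOneSpectrum R := ⟨m, hm.isPrime, hm0⟩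
  have hvP : v ∈ P := (hP v).mpr hsm
  by_cases hr : r ∈ m
  · refine ht ?_
    simp only [Set.mem_iUnion]
    refine ⟨v, by simpa [hvP] using hr, ?_⟩
    have := m.sub_mem hrm hr
    simpa [v] using this
  · have h1 : J ≤ m := Ideal.mul_le_right.trans
      ((Ideal.IsPrime.prod_le hm.isPrime).mpr ⟨v, by simp [hvP]; exact hr, le_rfl⟩)
    exact hr (by simpa using m.sub_mem hrm (h1 htJ))

/-- The smaller ideal is the annihilator of the quotient, hence intrinsic; the other then comes from
the common product by cancellation. -/
theorem eq_of_rowMap_pairSubmodule_eq {c d c' d' : Ideal R} (h : c ≤ d) (h' : c' ≤ d')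
    (hmul : c * d = c' * d') (hc : c ≠ ⊥) {C C' : GL (Fin 2) R}
    (heq : rowMap (pairSubmodule c d) C = rowMap (pairSubmodule c' d') C') :
    c = c' ∧ d = d' := by
  have h1 : c = c' := by
    ext r
    rw [mem_iff_smul_mem_rowMap h C, mem_iff_smul_mem_rowMap h' C', heq]
  subst h1
  exact ⟨rfl, mul_left_cancel₀ hc hmul⟩

/-- The stabilizer of `𝔫𝔡 ⊕ 𝔡` consists of the matrices whose lower left entry lies in `𝔫`. -/
theorem rowMap_pairSubmodule_eq_self_iff {n d : Ideal R} (hd : d ≠ ⊥) (γ : GL (Fin 2) R) :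
    rowMap (pairSubmodule (n * d) d) γ = pairSubmodule (n * d) d ↔ γ 1 0 ∈ n := by
  have key : ∀ γ : GL (Fin 2) R, γ 1 0 ∈ n →
      rowMap (pairSubmodule (n * d) d) γ ≤ pairSubmodule (n * d) d := by
    rintro γ hγ _ ⟨w, hw, rfl⟩
    refine ⟨?_, ?_⟩ <;>
      simp only [Matrix.vecMulLinear_apply, Matrix.vecMul, dotProduct, Fin.sum_univ_two]
    · have h1 := Ideal.mul_mem_mul hγ hw.2
      rw [mul_comm (γ 1 0)] at h1
      exact add_mem ((n * d).mul_mem_right _ hw.1) h1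
    · have h1 : w 0 ∈ d := Ideal.mul_le_right hw.1
      exact add_mem (d.mul_mem_right _ h1) (d.mul_mem_right _ hw.2)
  constructor
  · intro h
    -- Tested on the rows `(0, z)` with `z ∈ d`, whose images have first entry `z γ₁₀`; then `d`
    -- cancels.
    have h1 : Ideal.span {γ 1 0} * d ≤ n * d := by
      rw [Ideal.span_singleton_mul_le_iff]
      intro z hz
      have h2 : (![0, z] : Fin 2 → R) ᵥ* (γ : Matrix (Fin 2) (Fin 2) R) ∈
          pairSubmodule (n * d) d := by
        rw [← h]
        exact ⟨_, ⟨by simp, by simpa using hz⟩, rfl⟩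
      have h3 := h2.1
      simpa [Matrix.vecMul, dotProduct, mul_comm] using h3
    rw [← Ideal.span_singleton_le_iff_mem, ← Ideal.dvd_iff_le]
    rw [← Ideal.dvd_iff_le] at h1
    exact (mul_dvd_mul_iff_right hd).mp h1
  · intro h
    refine le_antisymm (key γ h) ?_
    have h2 : (γ⁻¹ : GL (Fin 2) R) 1 0 ∈ n := by
      rw [Matrix.coe_units_inv, Matrix.inv_def, Matrix.adjugate_fin_two]
      have h := n.mul_mem_left (Ring.inverse (γ : Matrix (Fin 2) (Fin 2) R).det) (n.neg_mem h)
      simpa [-mul_neg] using h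
    intro w hw
    rw [mem_rowMap_iff]
    exact key γ⁻¹ h2 ⟨w, hw, rfl⟩

theorem rowMap_pairSubmodule_eq_iff {n d : Ideal R} (hd : d ≠ ⊥) (C C' : GL (Fin 2) R) :
    rowMap (pairSubmodule (n * d) d) C = rowMap (pairSubmodule (n * d) d) C' ↔
      (C * C'⁻¹) 1 0 ∈ n := by
  rw [rowMap_eq_iff, rowMap_pairSubmodule_eq_self_iff hd]

/-- Elementary divisors: a submodule of `R²` with quotient `R/𝔠₁ ⊕ R/𝔠₂`, `𝔠₁ ∣ 𝔠₂`, is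
`(𝔠₂ ⊕ 𝔠₁) C` with `C` invertible. -/
theorem exists_rowMap_pairSubmodule_eq {c₁ c₂ : Ideal R} (hle : c₂ ≤ c₁) (hc : c₂ ≠ ⊥)
    (N : Submodule R (Fin 2 → R)) (e : ((Fin 2 → R) ⧸ N) ≃ₗ[R] ((R ⧸ c₁) × (R ⧸ c₂))) :
    ∃ C : GL (Fin 2) R, N = rowMap (pairSubmodule c₂ c₁) C := by
  set F : (Fin 2 → R) →ₗ[R] ((R ⧸ c₁) × (R ⧸ c₂)) := e.toLinearMap ∘ₗ N.mkQ
  have hFs : Function.Surjective F := e.surjective.comp N.mkQ_surjective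
  have hFk : ∀ v, v ∈ N ↔ F v = 0 := by
    intro v
    simp [F]
  have hexp : ∀ v : Fin 2 → R, v = v 0 • ![1, 0] + v 1 • ![0, 1] := by
    intro v
    ext i
    fin_cases i <;> simp
  obtain ⟨p, hp⟩ := Ideal.Quotient.mk_surjective (F ![1, 0]).1
  obtain ⟨q, hq⟩ := Ideal.Quotient.mk_surjective (F ![0, 1]).1
  obtain ⟨r, hr⟩ := Ideal.Quotient.mk_surjective (F ![1, 0]).2
  obtain ⟨s, hs⟩ := Ideal.Quotient.mk_surjective (F ![0, 1]).2
  have hF1 : ∀ v, (F v).1 = Ideal.Quotient.mk c₁ (v 0 * p + v 1 * q) := by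
    intro v
    conv_lhs => rw [hexp v]
    rw [map_add, map_smul, map_smul, Prod.fst_add, Prod.smul_fst, Prod.smul_fst, ← hp, ← hq]
    rfl
  have hF2 : ∀ v, (F v).2 = Ideal.Quotient.mk c₂ (v 0 * r + v 1 * s) := by
    intro v
    conv_lhs => rw [hexp v]
    rw [map_add, map_smul, map_smul, Prod.snd_add, Prod.smul_snd, Prod.smul_snd, ← hr, ← hs]
    rfl
  -- A preimage of `(0, 1)` writes `1` as a combination of `r` and `s` modulo `c₂`.
  have hrs : Ideal.span {r} ⊔ Ideal.span {s} ⊔ c₂ = ⊤ := by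
    obtain ⟨v, hv⟩ := hFs (0, 1)
    have h1 := hF2 v
    rw [hv, ← map_one (Ideal.Quotient.mk c₂), Ideal.Quotient.eq] at h1
    rw [Ideal.eq_top_iff_one]
    have h2 : (1 : R) = (v 0 * r + v 1 * s) + (1 - (v 0 * r + v 1 * s)) := by ring
    rw [h2]
    refine add_mem (Ideal.mem_sup_left (add_mem ?_ ?_)) (Ideal.mem_sup_right h1)
    · exact Ideal.mem_sup_left (Ideal.mul_mem_left _ _ (Ideal.mem_span_singleton_self r))
    · exact Ideal.mem_sup_right (Ideal.mul_mem_left _ _ (Ideal.mem_span_singleton_self s))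
  obtain ⟨r', s', hr', hs', x, y, hxy⟩ := exists_isCoprime_lift hc r s hrs
  have hF2' : ∀ v, (F v).2 = Ideal.Quotient.mk c₂ (v 0 * r' + v 1 * s') := by
    intro v
    rw [hF2, Ideal.Quotient.eq]
    have : v 0 * r + v 1 * s - (v 0 * r' + v 1 * s') =
        -(v 0 * (r' - r) + v 1 * (s' - s)) := by ring
    rw [this]
    exact neg_mem (add_mem (c₂.mul_mem_left _ hr') (c₂.mul_mem_left _ hs'))
  -- The unimodular column `(r', s')` is completed to determinant `1`. In the coordinates `v A = (w,
  -- w')`, the second component of `F` is just `w` modulo `c₂`.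
  set A : Matrix (Fin 2) (Fin 2) R := !![r', -y; s', x]
  set A' : Matrix (Fin 2) (Fin 2) R := !![x, y; -s', r']
  have hAA : A * A' = 1 := by
    ext i j
    fin_cases i <;> fin_cases j <;> simp [A, A', Matrix.mul_apply, Fin.sum_univ_two]
    · linear_combination hxy
    · ring
    · ring
    · linear_combination hxy
  have hAA' : A' * A = 1 := mul_eq_one_comm.mp hAA
  refine ⟨⟨A', A, hAA', hAA⟩, ?_⟩
  set u : R := x * p + y * q
  set z : R := -s' * p + r' * q
  have hF1' : ∀ v : Fin 2 → R, (F v).1 =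
      Ideal.Quotient.mk c₁ ((v 0 * r' + v 1 * s') * u + (-y * v 0 + x * v 1) * z) := by
    intro v
    rw [hF1]
    congr 1
    simp only [u, z]
    linear_combination (-(v 0 * p + v 1 * q)) * hxy
  -- `z` is a unit modulo `c₁`: for a preimage of `(1, 0)`, `w ∈ c₂ ⊆ c₁` removes the term in `u`,
  -- leaving `w' z ≡ 1`. Hence `F v = 0` exactly when `w ∈ c₂` and `w' ∈ c₁`.
  obtain ⟨t, ht⟩ : ∃ t, t * z - 1 ∈ c₁ := by
    obtain ⟨v, hv⟩ := hFs (1, 0)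
    have h1 := hF1' v
    have h2 := hF2' v
    rw [hv, ← map_one (Ideal.Quotient.mk c₁), eq_comm, Ideal.Quotient.eq] at h1
    rw [hv, eq_comm, Ideal.Quotient.eq_zero_iff_mem] at h2
    refine ⟨-y * v 0 + x * v 1, ?_⟩
    have := sub_mem h1 (c₁.mul_mem_right u (hle h2))
    convert this using 1
    ring
  ext v
  have hcoe : (((⟨A', A, hAA', hAA⟩ : GL (Fin 2) R)⁻¹ : GL (Fin 2) R) :
      Matrix (Fin 2) (Fin 2) R) = A := rfl
  rw [mem_rowMap_iff, hcoe, hFk, Prod.ext_iff, hF1', hF2', Prod.fst_zero, Prod.snd_zero,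
    Ideal.Quotient.eq_zero_iff_mem, Ideal.Quotient.eq_zero_iff_mem, mem_pairSubmodule]
  have hv0 : (v ᵥ* A) 0 = v 0 * r' + v 1 * s' := by
    simp [A, Matrix.vecMul, dotProduct, Fin.sum_univ_two]
  have hv1 : (v ᵥ* A) 1 = -y * v 0 + x * v 1 := by
    simp [A, Matrix.vecMul, dotProduct, Fin.sum_univ_two]
    ring
  rw [hv0, hv1]
  set w := v 0 * r' + v 1 * s'
  set w' := -y * v 0 + x * v 1
  constructor
  · rintro ⟨h1, h2⟩
    refine ⟨h2, ?_⟩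
    have h3 : w' * z ∈ c₁ := by
      have := sub_mem h1 (c₁.mul_mem_right u (hle h2))
      simpa using this
    have : w' = t * (w' * z) - w' * (t * z - 1) := by ring
    rw [this]
    exact sub_mem (c₁.mul_mem_left _ h3) (c₁.mul_mem_left _ ht)
  · rintro ⟨h1, h2⟩
    exact ⟨add_mem (c₁.mul_mem_right _ (hle h1)) (c₁.mul_mem_right _ h2), h1⟩

/-- If `𝔠𝔡` is principal, then `𝔠 ⊕ 𝔡` is free, with a basis of prescribed determinant. -/
theorem exists_rowMap_top_eq_pairSubmodule {c d : Ideal R} {β : R} (hβ : β ≠ 0)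
    (h : c * d = Ideal.span {β}) :
    ∃ B : Matrix (Fin 2) (Fin 2) R, rowMap ⊤ B = pairSubmodule c d ∧ B.det = β := by
  have hc : c ≠ ⊥ := by
    rintro rfl
    rw [Ideal.bot_mul, eq_comm, Ideal.span_singleton_eq_bot] at h
    exact hβ h
  obtain ⟨x, hx, hx0⟩ := Submodule.exists_mem_ne_zero_of_ne_bot hc
  -- Two elements generate `c = (x, x')`. Then `β ∈ x d + x' d` gives `x y + x' z = β`, the
  -- determinant of the matrix chosen below.
  obtain ⟨x', hx'⟩ := IsDedekindDomain.exists_sup_span_eq (I := Ideal.span {x}) (J := c)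
    (by rwa [Ideal.span_singleton_le_iff_mem]) (by simpa using hx0)
  have hx'c : x' ∈ c := hx' ▸ Ideal.mem_sup_right (Ideal.mem_span_singleton_self x')
  have hmem : β ∈ Ideal.span {x} * d ⊔ Ideal.span {x'} * d := by
    rw [← Ideal.sup_mul, hx', h]
    exact Ideal.mem_span_singleton_self β
  obtain ⟨_, hy, _, hz, hyz⟩ := Submodule.mem_sup.mp hmem
  obtain ⟨y, hyd, rfl⟩ := Ideal.mem_span_singleton_mul.mp hy
  obtain ⟨z, hzd, rfl⟩ := Ideal.mem_span_singleton_mul.mp hz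
  refine ⟨!![x, -z; x', y], ?_, by rw [Matrix.det_fin_two_of]; linear_combination hyz⟩
  apply le_antisymm
  · rintro _ ⟨w, -, rfl⟩
    rw [Matrix.vecMulLinear_apply, mem_pairSubmodule]
    simp only [Matrix.vecMul, dotProduct, Fin.sum_univ_two, Matrix.of_apply, Matrix.cons_val_zero,
      Matrix.cons_val_one]
    exact ⟨add_mem (c.mul_mem_left _ hx) (c.mul_mem_left _ hx'c),
      add_mem (d.mul_mem_left _ (neg_mem hzd)) (d.mul_mem_left _ hyd)⟩
  · intro w hw
    -- Cramer's rule: these are the entries of `w` times the adjugate. They lie in `c d = (β)`, so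
    -- the division by `β` is possible in `R`.
    have h1 : w 0 * y - x' * w 1 ∈ c * d :=
      sub_mem (Ideal.mul_mem_mul hw.1 hyd) (Ideal.mul_mem_mul hx'c hw.2)
    have h2 : w 0 * z + x * w 1 ∈ c * d :=
      add_mem (Ideal.mul_mem_mul hw.1 hzd) (Ideal.mul_mem_mul hx hw.2)
    rw [h, Ideal.mem_span_singleton] at h1 h2
    obtain ⟨k, hk⟩ := h1
    obtain ⟨l, hl⟩ := h2
    refine ⟨![k, l], Submodule.mem_top, ?_⟩
    rw [Matrix.vecMulLinear_apply]
    ext i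
    apply mul_left_cancel₀ hβ
    fin_cases i <;> simp [Matrix.vecMul, dotProduct, Fin.sum_univ_two, -mul_eq_mul_left_iff]
    · linear_combination (-x) * hk - x' * hl + w 0 * hyz
    · linear_combination z * hk - y * hl + w 1 * hyz

end Rows

/-! ### The identity `η(𝔟) = ∑ ψ(𝔟₁)`. -/

section Arithmetic

open UniqueFactorizationMonoid

variable {K : Type*} [Field K]

theorem factorizations_one : factorizations (1 : Ideal (𝓞 K)) = {(1, 1)} := by
  ext ⟨x, y⟩
  simp only [factorizations, Set.mem_ofPred_eq, Set.mem_singleton_iff, Prod.mk.injEq]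
  constructor
  · intro h
    have hx : x = 1 := by simpa using IsUnit.of_mul_eq_one _ h
    have hy : y = 1 := by
      rw [hx, one_mul, sq] at h
      simpa using IsUnit.of_mul_eq_one _ h
    exact ⟨hx, hy⟩
  · rintro ⟨rfl, rfl⟩
    simp

variable [NumberField K]

-- Coprime ideals have disjoint sets of prime factors. Allowing `F` to depend on the exponent covers
-- `η` and `ψ` at once.
open scoped Classical in
theorem prod_normalizedFactors_mul_of_isRelPrime {α : Type*} [CommMonoid α]
    (F : Ideal (𝓞 K) → ℕ → α) {x y : Ideal (𝓞 K)} (hx : x ≠ 0) (hy : y ≠ 0)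
    (h : IsRelPrime x y) :
    ∏ p ∈ (normalizedFactors (x * y)).toFinset, F p ((normalizedFactors (x * y)).count p) =
      (∏ p ∈ (normalizedFactors x).toFinset, F p ((normalizedFactors x).count p)) *
        ∏ p ∈ (normalizedFactors y).toFinset, F p ((normalizedFactors y).count p) := by
  have hd : ∀ p, p ∈ normalizedFactors x → p ∉ normalizedFactors y := by
    intro p hp hp'
    exact (prime_of_normalized_factor p hp).not_isUnit
      (h (dvd_of_mem_normalizedFactors hp) (dvd_of_mem_normalizedFactors hp'))
  rw [normalizedFactors_mul hx hy, Multiset.toFinset_add, Finset.prod_union]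
  · congr 1
    · refine Finset.prod_congr rfl fun p hp => ?_
      rw [Multiset.count_add, Multiset.count_eq_zero_of_notMem (hd p (Multiset.mem_toFinset.mp hp)), add_zero]
    · refine Finset.prod_congr rfl fun p hp => ?_
      rw [Multiset.count_add, Multiset.count_eq_zero_of_notMem (s := normalizedFactors x)
        (fun h' => hd p h' (Multiset.mem_toFinset.mp hp)), zero_add]
  · rw [Finset.disjoint_left]
    intro p hp hp'
    exact hd p (Multiset.mem_toFinset.mp hp) (Multiset.mem_toFinset.mp hp')

theorem eta_mul_of_isRelPrime {x y : Ideal (𝓞 K)} (hx : x ≠ 0) (hy : y ≠ 0)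
    (h : IsRelPrime x y) : eta (x * y) = eta x * eta y :=
  prod_normalizedFactors_mul_of_isRelPrime
    (fun p e => ∑ k ∈ Finset.range (e + 1), Ideal.absNorm p ^ k) hx hy h

theorem psi_mul_of_isRelPrime {x y : Ideal (𝓞 K)} (hx : x ≠ 0) (hy : y ≠ 0)
    (h : IsRelPrime x y) : psi (x * y) = psi x * psi y := by
  have := prod_normalizedFactors_mul_of_isRelPrime
    (fun p _ => 1 + (Ideal.absNorm p : ℚ)⁻¹) hx hy h
  rw [psi, psi, psi, this, map_mul]
  push_cast
  ring

theorem eta_one : eta (1 : Ideal (𝓞 K)) = 1 := by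
  rw [eta, normalizedFactors_one, Multiset.toFinset_zero, Finset.prod_empty]

theorem psi_one : psi (1 : Ideal (𝓞 K)) = 1 := by
  rw [psi, normalizedFactors_one, Multiset.toFinset_zero, Finset.prod_empty, map_one, Nat.cast_one,
    one_mul]

theorem absNorm_pos {p : Ideal (𝓞 K)} (hp : p ≠ 0) : (0 : ℚ) < Ideal.absNorm p := by
  exact_mod_cast Ideal.absNorm_pos_iff_mem_nonZeroDivisors.mpr (mem_nonZeroDivisors_of_ne_zero hp)

theorem psi_mul_prime_of_dvd {n p : Ideal (𝓞 K)} (hn : n ≠ 0) (hp : Prime p) (h : p ∣ n) :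
    psi (n * p) = psi n * Ideal.absNorm p := by
  have h1 : (normalizedFactors (n * p)).toFinset = (normalizedFactors n).toFinset := by
    ext q
    rw [Multiset.mem_toFinset, Multiset.mem_toFinset, mem_normalizedFactors_iff' (mul_ne_zero hn hp.ne_zero),
      mem_normalizedFactors_iff' hn]
    refine and_congr_right fun hq => and_congr_right fun _ => ⟨fun hd => ?_, fun hd => hd.mul_right _⟩
    exact (hq.prime.dvd_or_dvd hd).elim id (fun h' => h'.trans h)
  rw [psi, psi, h1, map_mul]
  push_cast
  ring

theorem psi_prime {p : Ideal (𝓞 K)} (hp : Prime p) : psi p = Ideal.absNorm p + 1 := by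
  have := (absNorm_pos hp.ne_zero).ne'
  rw [psi, normalizedFactors_irreducible hp.irreducible]
  simp
  field_simp

theorem psi_mul_prime_of_not_dvd {n p : Ideal (𝓞 K)} (hn : n ≠ 0) (hp : Prime p) (h : ¬ p ∣ n) :
    psi (n * p) = psi n * (Ideal.absNorm p + 1) := by
  rw [psi_mul_of_isRelPrime hn hp.ne_zero (((hp.irreducible.isRelPrime_iff_not_dvd).mpr h).symm),
    psi_prime hp]

theorem psi_prime_pow_succ {p : Ideal (𝓞 K)} (hp : Prime p) (k : ℕ) :
    psi (p ^ (k + 1)) = (Ideal.absNorm p : ℚ) ^ (k + 1) + (Ideal.absNorm p : ℚ) ^ k := by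
  induction k with
  | zero => simp [psi_prime hp]
  | succ k ih =>
    rw [pow_succ, psi_mul_prime_of_dvd (pow_ne_zero _ hp.ne_zero) hp (dvd_pow_self p k.succ_ne_zero), ih]
    ring

theorem eta_prime_pow {p : Ideal (𝓞 K)} (hp : Prime p) (e : ℕ) :
    eta (p ^ e) = ∑ k ∈ Finset.range (e + 1), Ideal.absNorm p ^ k := by
  rcases e.eq_zero_or_pos with rfl | he
  · rw [pow_zero, eta_one, zero_add, Finset.sum_range_one, pow_zero]
  · rw [eta, normalizedFactors_pow, normalizedFactors_irreducible hp.irreducible]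
    simp [he.ne']

theorem finite_factorizations {b : Ideal (𝓞 K)} (hb : b ≠ 0) : (factorizations b).Finite := by
  have hfin : {x : Ideal (𝓞 K) | x ∣ b}.Finite := by
    have := fintypeSubtypeDvd b hb
    exact Set.finite_coe_iff.mp (inferInstance : Finite {x : Ideal (𝓞 K) // x ∣ b})
  refine (hfin.prod hfin).subset ?_
  rintro ⟨x, y⟩ (h : x * y ^ 2 = b)
  exact ⟨⟨_, h.symm⟩, (dvd_pow_self y two_ne_zero).trans ⟨x, by rw [← h, mul_comm]⟩⟩

/-- For coprime `x` and `y`, each divisor of `x y` splits uniquely into a divisor of `x` and one of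
`y`; this is applied to both entries of a factorization. -/
theorem bijOn_factorizations_mul {x y : Ideal (𝓞 K)} (hx : x ≠ 0)
    (h : IsRelPrime x y) :
    Set.BijOn (fun f : (Ideal (𝓞 K) × Ideal (𝓞 K)) × (Ideal (𝓞 K) × Ideal (𝓞 K)) => f.1 * f.2)
      (factorizations x ×ˢ factorizations y) (factorizations (x * y)) := by
  have key : ∀ {d e d' e' : Ideal (𝓞 K)}, d ∣ x → e ∣ y → d' ∣ x → e' ∣ y → d * e = d' * e' →
      d = d' := by
    intro d e d' e' h1 h2 h3 h4 heq
    apply dvd_antisymm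
    · exact (h.of_dvd_left h1 |>.of_dvd_right h4).dvd_of_dvd_mul_right (heq ▸ dvd_mul_right d e)
    · exact (h.of_dvd_left h3 |>.of_dvd_right h2).dvd_of_dvd_mul_right (heq ▸ dvd_mul_right d' e')
  have key' : ∀ {d e d' e' : Ideal (𝓞 K)}, d ∣ x → e ∣ y → d' ∣ x → e' ∣ y → d * e = d' * e' →
      e = e' := by
    intro d e d' e' h1 h2 h3 h4 heq
    have hd := key h1 h2 h3 h4 heq
    subst hd
    exact mul_left_cancel₀ (ne_zero_of_dvd_ne_zero hx h1) heq
  have hdvd : ∀ {f : Ideal (𝓞 K) × Ideal (𝓞 K)} {z}, f ∈ factorizations z → f.1 ∣ z ∧ f.2 ∣ z := by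
    rintro f z (rfl : f.1 * f.2 ^ 2 = z)
    exact ⟨dvd_mul_right _ _, (dvd_pow_self _ two_ne_zero).mul_left _⟩
  refine ⟨?_, ?_, ?_⟩
  · rintro ⟨f, f'⟩ ⟨hf, hf'⟩
    change f.1 * f'.1 * (f.2 * f'.2) ^ 2 = x * y
    change f.1 * f.2 ^ 2 = x at hf
    change f'.1 * f'.2 ^ 2 = y at hf'
    rw [← hf, ← hf']
    ring
  · rintro ⟨f, f'⟩ ⟨hf, hf'⟩ ⟨g, g'⟩ ⟨hg, hg'⟩ heq
    have h1 : f.1 * f'.1 = g.1 * g'.1 := congrArg Prod.fst heq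
    have h2 : f.2 * f'.2 = g.2 * g'.2 := congrArg Prod.snd heq
    refine Prod.ext (Prod.ext ?_ ?_) (Prod.ext ?_ ?_)
    · exact key (hdvd hf).1 (hdvd hf').1 (hdvd hg).1 (hdvd hg').1 h1
    · exact key (hdvd hf).2 (hdvd hf').2 (hdvd hg).2 (hdvd hg').2 h2
    · exact key' (hdvd hf).1 (hdvd hf').1 (hdvd hg).1 (hdvd hg').1 h1
    · exact key' (hdvd hf).2 (hdvd hf').2 (hdvd hg).2 (hdvd hg').2 h2
  · rintro ⟨u, v⟩ (huv : u * v ^ 2 = x * y)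
    have hu : u ∣ x * y := ⟨_, huv.symm⟩
    have hv : v ^ 2 ∣ x * y := ⟨u, by rw [← huv, mul_comm]⟩
    obtain ⟨d, e, hd, he, rfl⟩ := exists_dvd_and_dvd_of_dvd_mul hu
    obtain ⟨d', e', hd', he', rfl⟩ :=
      exists_dvd_and_dvd_of_dvd_mul ((dvd_pow_self v two_ne_zero).trans hv)
    have heq : (d * d' ^ 2) * (e * e' ^ 2) = x * y := by rw [← huv]; ring
    have hxd : IsRelPrime x (e * e' ^ 2) :=
      IsRelPrime.mul_right (h.of_dvd_right he) (IsRelPrime.pow_right (h.of_dvd_right he'))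
    have hyd : IsRelPrime (d * d' ^ 2) y :=
      IsRelPrime.mul_left (h.of_dvd_left hd) (IsRelPrime.pow_left (h.of_dvd_left hd'))
    have h1 : d * d' ^ 2 = x := by
      apply dvd_antisymm
      · exact hyd.dvd_of_dvd_mul_right (heq ▸ dvd_mul_right _ _)
      · exact hxd.dvd_of_dvd_mul_right (heq ▸ dvd_mul_right _ _)
    have h2 : e * e' ^ 2 = y := by
      rw [h1] at heq
      exact mul_left_cancel₀ hx heq
    exact ⟨((d, d'), (e, e')), ⟨h1, h2⟩, rfl⟩

theorem finsum_psi_mul_of_isRelPrime {x y : Ideal (𝓞 K)} (hx : x ≠ 0) (hy : y ≠ 0)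
    (h : IsRelPrime x y) :
    ∑ᶠ f ∈ factorizations (x * y), psi f.1 =
      (∑ᶠ f ∈ factorizations x, psi f.1) * ∑ᶠ f ∈ factorizations y, psi f.1 := by
  rw [← finsum_mem_eq_of_bijOn _ (bijOn_factorizations_mul hx h) (fun _ _ => rfl),
    finsum_mem_eq_finite_toFinset_sum _ (finite_factorizations hx),
    finsum_mem_eq_finite_toFinset_sum _ (finite_factorizations hy), Finset.sum_mul_sum,
    ← Finset.sum_product',
    finsum_mem_eq_finite_toFinset_sum _ ((finite_factorizations hx).prod (finite_factorizations hy)),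
    Set.Finite.toFinset_prod]
  refine Finset.sum_congr rfl ?_
  rintro ⟨f, f'⟩ hf
  rw [Set.Finite.mem_toFinset] at hf
  obtain ⟨hf, hf'⟩ := hf
  exact psi_mul_of_isRelPrime (left_ne_zero_of_mul (hf.trans_ne hx))
    (left_ne_zero_of_mul (hf'.trans_ne hy))
    ((h.of_dvd_left ⟨_, hf.symm⟩).of_dvd_right ⟨_, hf'.symm⟩)

theorem factorizations_prime {p : Ideal (𝓞 K)} (hp : Prime p) :
    factorizations p = {(p, 1)} := by
  ext ⟨x, y⟩
  simp only [factorizations, Set.mem_ofPred_eq, Set.mem_singleton_iff, Prod.mk.injEq]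
  constructor
  · intro h
    have hy : y = 1 := by
      by_contra hy
      refine hp.irreducible.squarefree y ?_ |> fun hu => hy (by simpa using hu)
      exact ⟨x, by rw [← h]; ring⟩
    subst hy
    rw [one_pow, mul_one] at h
    exact ⟨h, rfl⟩
  · rintro ⟨rfl, rfl⟩
    rw [one_pow, mul_one]

/-- The second entry is a power of `p`: either it is `1`, or one factor `p` can be removed from it,
lowering the exponent by two. -/
theorem factorizations_prime_pow_add_two {p : Ideal (𝓞 K)} (hp : Prime p) (e : ℕ) :
    factorizations (p ^ (e + 2)) =
      insert (p ^ (e + 2), 1) ((fun f => (f.1, f.2 * p)) '' factorizations (p ^ e)) := by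
  ext ⟨x, y⟩
  simp only [factorizations, Set.mem_ofPred_eq, Set.mem_insert_iff, Set.mem_image, Prod.mk.injEq,
    Prod.exists]
  constructor
  · intro h
    have hy : y ∣ p ^ (e + 2) := ⟨x * y, by rw [← h]; ring⟩
    obtain ⟨i, -, hi⟩ := (dvd_prime_pow hp _).mp hy
    rw [associated_iff_eq] at hi
    rcases i with - | i
    · rw [pow_zero] at hi
      subst hi
      rw [one_pow, mul_one] at h
      exact Or.inl ⟨h, rfl⟩
    · right
      refine ⟨x, p ^ i, ?_, rfl, by rw [hi, pow_succ]⟩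
      rw [hi] at h
      apply mul_right_cancel₀ (pow_ne_zero 2 hp.ne_zero)
      rw [← pow_add, ← h]
      ring
  · rintro (⟨rfl, rfl⟩ | ⟨u, v, h, rfl, rfl⟩)
    · rw [one_pow, mul_one]
    · rw [pow_add, ← h]
      ring

/-- In passing from `e` to `e + 2`, the new factorization contributes `ψ(p^(e+2)) = N(p)^(e+2) +
N(p)^(e+1)`, exactly the two top terms of `η(p^(e+2))`. -/
theorem eta_eq_finsum_psi_prime_pow {p : Ideal (𝓞 K)} (hp : Prime p) (e : ℕ) :
    (eta (p ^ e) : ℚ) = ∑ᶠ f ∈ factorizations (p ^ e), psi f.1 := by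
  induction e using Nat.twoStepInduction with
  | zero =>
    rw [pow_zero, factorizations_one, finsum_mem_singleton, psi_one, eta_one,
      Nat.cast_one]
  | one =>
    rw [eta_prime_pow hp, pow_one, factorizations_prime hp, finsum_mem_singleton, psi_prime hp]
    simp [Finset.sum_range_succ, add_comm]
  | more e ih _ =>
    have hinj : Set.InjOn (fun f : Ideal (𝓞 K) × Ideal (𝓞 K) => (f.1, f.2 * p))
        (factorizations (p ^ e)) := by
      rintro ⟨x, y⟩ - ⟨x', y'⟩ - h
      simp only [Prod.mk.injEq] at h
      rw [h.1, mul_right_cancel₀ hp.ne_zero h.2]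
    rw [factorizations_prime_pow_add_two hp, finsum_mem_insert, finsum_mem_image hinj, ← ih,
      psi_prime_pow_succ hp, eta_prime_pow hp, eta_prime_pow hp,
      Finset.sum_range_succ, Finset.sum_range_succ _ (e + 1)]
    · push_cast
      ring
    · rintro ⟨f, -, hf⟩
      simp only [Prod.mk.injEq] at hf
      exact hp.not_isUnit (IsUnit.of_mul_eq_one f.2 (by rw [mul_comm]; exact hf.2))
    · exact (finite_factorizations (pow_ne_zero _ hp.ne_zero)).image _

/-- `η(𝔟) = ∑ ψ(𝔟₁)`, over the factorizations `𝔟 = 𝔟₁ 𝔟₂²`. -/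
theorem eta_eq_finsum_psi {b : Ideal (𝓞 K)} (hb : b ≠ 0) :
    (eta b : ℚ) = ∑ᶠ f ∈ factorizations b, psi f.1 := by
  induction b using UniqueFactorizationMonoid.induction_on_coprime with
  | h0 => exact absurd rfl hb
  | @h1 x hx =>
    have : x = 1 := by simpa using hx
    rw [this, factorizations_one, finsum_mem_singleton, psi_one, eta_one,
      Nat.cast_one]
  | hpr i hp => exact eta_eq_finsum_psi_prime_pow hp i
  | @hcp x y hxy ihx ihy =>
    have hx := left_ne_zero_of_mul hb
    have hy := right_ne_zero_of_mul hb
    rw [eta_mul_of_isRelPrime hx hy hxy, finsum_psi_mul_of_isRelPrime hx hy hxy, Nat.cast_mul,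
      ihx hx, ihy hy]

end Arithmetic

/-! ### The index of `Γ₀(𝔫)`. -/

section Index

/-- The index of a subgroup is the number of elements of a family of representatives. -/
theorem index_eq_card_of_existsUnique {G X : Type*} [Group G] (H : Subgroup G) (T : X → G)
    (hT : ∀ g, ∃! x, g * (T x)⁻¹ ∈ H) : H.index = Nat.card X := by
  have hinj : Function.Injective T := by
    intro x y hxy
    refine (hT (T x)).unique ?_ ?_
    · rw [mul_inv_cancel]
      exact H.one_mem
    · rw [hxy, mul_inv_cancel]
      exact H.one_mem
  have hc : Subgroup.IsComplement (H : Set G) (Set.range T) := by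
    rw [Subgroup.isComplement_iff_existsUnique_mul_inv_mem]
    intro g
    obtain ⟨x, hx, hu⟩ := hT g
    refine ⟨⟨T x, x, rfl⟩, hx, ?_⟩
    rintro ⟨_, y, rfl⟩ hy
    exact Subtype.ext (congrArg T (hu y hy))
  rw [← hc.card_right]
  exact (Nat.card_congr (Equiv.ofInjective T hinj)).symm

variable {R : Type*} [CommRing R]

/-- The unipotent matrix with rows `(1, 0)` and `(t, 1)`. -/
def lowerUnipotent (t : R) : GL (Fin 2) R :=
  ⟨!![1, 0; t, 1], !![1, 0; -t, 1], by simp [Matrix.one_fin_two], by simp [Matrix.one_fin_two]⟩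

theorem mul_lowerUnipotent_inv_apply (γ : GL (Fin 2) R) (t : R) :
    (γ * (lowerUnipotent t)⁻¹) 1 0 = γ 1 0 - γ 1 1 * t := by
  have : (((lowerUnipotent t)⁻¹ : GL (Fin 2) R) : Matrix (Fin 2) (Fin 2) R) =
    !![1, 0; -t, 1] := rfl
  rw [Matrix.GeneralLinearGroup.coe_mul, this, Matrix.mul_apply, Fin.sum_univ_two]
  simp
  ring

/-- The matrix with rows `(1, -1)` and `(s, d)`, where `s + d = 1`. -/
def cuspMatrix (s d : R) (h : s + d = 1) : GL (Fin 2) R :=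
  ⟨!![1, -1; s, d], !![d, 1; -s, 1], by
    ext i j
    fin_cases i <;> fin_cases j <;> simp [Matrix.mul_apply, Fin.sum_univ_two]
    · linear_combination h
    · ring
    · linear_combination h, by
    ext i j
    fin_cases i <;> fin_cases j <;> simp [Matrix.mul_apply, Fin.sum_univ_two]
    · linear_combination h
    · linear_combination h⟩

theorem mul_cuspMatrix_inv_apply (γ : GL (Fin 2) R) (s d : R) (h : s + d = 1) :
    (γ * (cuspMatrix s d h)⁻¹) 1 0 = γ 1 0 * d - γ 1 1 * s := by
  have : (((cuspMatrix s d h)⁻¹ : GL (Fin 2) R) : Matrix (Fin 2) (Fin 2) R) =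
    !![d, 1; -s, 1] := rfl
  rw [Matrix.GeneralLinearGroup.coe_mul, this, Matrix.mul_apply, Fin.sum_univ_two]
  simp
  ring

theorem not_mem_lower_row (γ : GL (Fin 2) R) {p : Ideal R} (hp : p ≠ ⊤)
    (h0 : γ 1 0 ∈ p) (h1 : γ 1 1 ∈ p) : False := by
  apply hp
  have hu : IsUnit (γ : Matrix (Fin 2) (Fin 2) R).det := γ.isUnit.map Matrix.detMonoidHom
  refine Ideal.eq_top_of_isUnit_mem _ ?_ hu
  rw [Matrix.det_fin_two]
  exact sub_mem (p.mul_mem_left _ h1) (p.mul_mem_left _ h0)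

variable {K : Type*} [Field K]

theorem mem_Gamma0 {n : Ideal (𝓞 K)} {γ : GL (Fin 2) (𝓞 K)} : γ ∈ Gamma0 n ↔ γ 1 0 ∈ n := Iff.rfl

/-- `Γ₀(𝔫)` contains `diag(u⁻¹, 1)` for every unit `u`, so each coset can be normalized to
determinant `1`. -/
theorem exists_isUnimodularReps (n : Ideal (𝓞 K)) : ∃ S, IsUnimodularReps n S := by
  have h : ∀ q : Quotient (QuotientGroup.rightRel (Gamma0 n)), ∃ C : GL (Fin 2) (𝓞 K),
      Quotient.mk'' C = q ∧ (C : Matrix (Fin 2) (Fin 2) (𝓞 K)).det = 1 := by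
    intro q
    obtain ⟨γ, rfl⟩ := Quotient.mk''_surjective q
    set u : (𝓞 K)ˣ := Matrix.GeneralLinearGroup.det γ
    set D : GL (Fin 2) (𝓞 K) := Matrix.GeneralLinearGroup.mk'' !![((u⁻¹ : (𝓞 K)ˣ) : 𝓞 K), 0; 0, 1]
      (by rw [Matrix.det_fin_two_of]; simp)
    have hD : D ∈ Gamma0 n := by
      rw [mem_Gamma0]
      simp [D]
    refine ⟨D * γ, ?_, ?_⟩
    · rw [Quotient.eq'', QuotientGroup.rightRel_apply]
      simpa using inv_mem hD
    · have h1 : (D : Matrix (Fin 2) (Fin 2) (𝓞 K)).det = ((u⁻¹ : (𝓞 K)ˣ) : 𝓞 K) := by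
        change Matrix.det !![((u⁻¹ : (𝓞 K)ˣ) : 𝓞 K), 0; 0, 1] = _
        rw [Matrix.det_fin_two_of]
        simp
      have h2 : (γ : Matrix (Fin 2) (Fin 2) (𝓞 K)).det = (u : 𝓞 K) := rfl
      rw [Matrix.GeneralLinearGroup.coe_mul, Matrix.det_mul, h1, h2, Units.inv_mul]
  choose f hf hdet using h
  refine ⟨Set.range f, ?_, Subgroup.isComplement_range_right hf⟩
  rintro _ ⟨q, rfl⟩
  exact hdet q

/-- The equation `c ≡ d t` modulo `𝔫𝔭`, with `c ∈ 𝔫` and `d` a unit modulo `𝔭`, has a unique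
solution `t` in `𝔫 / 𝔫𝔭`. -/
theorem existsUnique_quotient_sub_mul_mem {n p : Ideal (𝓞 K)} (hp : p.IsMaximal) {c d : 𝓞 K}
    (hc : c ∈ n) (hd : d ∉ p) :
    ∃! q : n.toAddSubgroup ⧸ (n * p).toAddSubgroup.addSubgroupOf n.toAddSubgroup,
      c - d * (q.out : 𝓞 K) ∈ n * p := by
  obtain ⟨e, i, hi, he⟩ := hp.exists_inv hd
  -- `e` inverts `d` modulo `p`; since `c ∈ n`, the error `c (1 - e d)` falls into `n p`.
  refine ⟨QuotientAddGroup.mk ⟨e * c, n.mul_mem_left e hc⟩, ?_, ?_⟩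
  · obtain ⟨k, hk⟩ := QuotientAddGroup.mk_out_eq_add
      ((n * p).toAddSubgroup.addSubgroupOf n.toAddSubgroup) ⟨e * c, n.mul_mem_left e hc⟩
    have hk' : ((k : n.toAddSubgroup) : 𝓞 K) ∈ n * p := k.2
    rw [hk, AddSubgroup.coe_add]
    have : c - d * (e * c + ((k : n.toAddSubgroup) : 𝓞 K)) =
        c * i - d * ((k : n.toAddSubgroup) : 𝓞 K) := by linear_combination (-c) * he
    rw [this]
    exact sub_mem (Ideal.mul_mem_mul hc hi) ((n * p).mul_mem_left _ hk')
  · intro q hq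
    rw [← q.out_eq']
    refine QuotientAddGroup.eq.mpr ?_
    change -(q.out : 𝓞 K) + e * c ∈ n * p
    have : -(q.out : 𝓞 K) + e * c = e * (c - d * (q.out : 𝓞 K)) - (q.out : 𝓞 K) * i := by
      linear_combination (q.out : 𝓞 K) * he
    rw [this]
    exact sub_mem ((n * p).mul_mem_left _ hq) (Ideal.mul_mem_mul q.out.2 hi)

variable [NumberField K]

theorem index_eq_absNorm (n : Ideal (𝓞 K)) : n.toAddSubgroup.index = Ideal.absNorm n := rfl

theorem relIndex_ideal_mul {n : Ideal (𝓞 K)} (hn : n ≠ ⊥) (p : Ideal (𝓞 K)) :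
    (n * p).toAddSubgroup.relIndex n.toAddSubgroup = Ideal.absNorm p := by
  have h := AddSubgroup.relIndex_mul_index (H := (n * p).toAddSubgroup) (K := n.toAddSubgroup)
    (show (n * p).toAddSubgroup ≤ n.toAddSubgroup from fun _ hx => Ideal.mul_le_left hx)
  rw [index_eq_absNorm, index_eq_absNorm, map_mul, mul_comm] at h
  refine Nat.eq_of_mul_eq_mul_left (Nat.pos_of_ne_zero ?_) h
  rwa [Ne, Ideal.absNorm_eq_zero_iff]

/-- As `p ∣ n`, the lower left entry lies in `p`, so the lower right one is a unit modulo `p`. The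
lower unipotents with `t` in `n / np` then represent every coset once. -/
theorem relIndex_Gamma0_mul_of_dvd {n p : Ideal (𝓞 K)} (hn : n ≠ ⊥) (hp : p.IsMaximal)
    (h : p ∣ n) : (Gamma0 (n * p)).relIndex (Gamma0 n) = Ideal.absNorm p := by
  rw [← relIndex_ideal_mul hn p]
  refine index_eq_card_of_existsUnique ((Gamma0 (n * p)).subgroupOf (Gamma0 n))
    (fun q : n.toAddSubgroup ⧸ (n * p).toAddSubgroup.addSubgroupOf n.toAddSubgroup =>
      (⟨lowerUnipotent (q.out : 𝓞 K), q.out.2⟩ : Gamma0 n)) ?_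
  rintro ⟨γ, hγ⟩
  have hd : γ 1 1 ∉ p := fun h1 => not_mem_lower_row γ hp.ne_top (Ideal.le_of_dvd h hγ) h1
  refine (existsUnique_congr fun q => ?_).mpr (existsUnique_quotient_sub_mul_mem hp hγ hd)
  rw [← mul_lowerUnipotent_inv_apply]
  rfl

/-- The cosets match the points of the projective line over `𝓞 K / p`, through the lower row modulo
`p`. Unipotents give the affine points; one more matrix, with lower right entry in `p`, gives the
point at infinity. -/
theorem relIndex_Gamma0_mul_of_not_dvd {n p : Ideal (𝓞 K)} (hn : n ≠ ⊥) (hp : p.IsMaximal)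
    (h : ¬ p ∣ n) : (Gamma0 (n * p)).relIndex (Gamma0 n) = Ideal.absNorm p + 1 := by
  have hsup : n ⊔ p = ⊤ := by
    rw [sup_comm]
    exact hp.1.2 _ (lt_of_le_of_ne le_sup_left fun heq =>
      h (Ideal.dvd_iff_le.mpr (heq ▸ le_sup_right)))
  obtain ⟨s, hs, d, hd, hsd⟩ := Submodule.mem_sup.mp ((Ideal.eq_top_iff_one _).mp hsup)
  have hsp : s ∉ p := fun hsp =>
    hp.ne_top ((Ideal.eq_top_iff_one _).mpr (hsd ▸ p.add_mem hsp hd))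
  have hpos : Ideal.absNorm p ≠ 0 := by
    rw [Ne, Ideal.absNorm_eq_zero_iff]
    rintro rfl
    exact absurd hp (Ring.ne_bot_of_isMaximal_of_not_isField · (RingOfIntegers.not_isField K) rfl)
  have hrel := relIndex_ideal_mul hn p
  have hfin : Finite (n.toAddSubgroup ⧸ (n * p).toAddSubgroup.addSubgroupOf n.toAddSubgroup) := by
    refine Nat.finite_of_card_ne_zero ?_
    change (n * p).toAddSubgroup.relIndex n.toAddSubgroup ≠ 0
    rwa [hrel]
  have hcard : Nat.card (Option
      (n.toAddSubgroup ⧸ (n * p).toAddSubgroup.addSubgroupOf n.toAddSubgroup)) =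
      Ideal.absNorm p + 1 := by
    rw [Finite.card_option, ← hrel]
    rfl
  rw [← hcard]
  refine index_eq_card_of_existsUnique ((Gamma0 (n * p)).subgroupOf (Gamma0 n))
    (fun x : Option (n.toAddSubgroup ⧸ (n * p).toAddSubgroup.addSubgroupOf n.toAddSubgroup) =>
      (x.elim ⟨cuspMatrix s d hsd, hs⟩ fun q => ⟨lowerUnipotent (q.out : 𝓞 K), q.out.2⟩ :
        Gamma0 n)) ?_
  rintro ⟨γ, hγ⟩
  have hγ' : γ 1 0 ∈ n := hγ
  have hnone : γ 1 0 * d - γ 1 1 * s ∈ n * p ↔ γ 1 1 ∈ p := by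
    have hc : γ 1 0 * d ∈ n * p := Ideal.mul_mem_mul hγ' hd
    rw [Submodule.sub_mem_iff_right _ hc]
    constructor
    · intro h1
      exact (hp.isPrime.mem_or_mem (Ideal.mul_le_right h1)).resolve_right hsp
    · intro h1
      rw [mul_comm (γ 1 1)]
      exact Ideal.mul_mem_mul hs h1
  have hmem : ∀ x : Option (n.toAddSubgroup ⧸ (n * p).toAddSubgroup.addSubgroupOf n.toAddSubgroup),
      ((⟨γ, hγ⟩ : Gamma0 n) * (x.elim ⟨cuspMatrix s d hsd, hs⟩ fun q =>
        ⟨lowerUnipotent (q.out : 𝓞 K), q.out.2⟩ : Gamma0 n)⁻¹ ∈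
          (Gamma0 (n * p)).subgroupOf (Gamma0 n)) ↔
      x.elim (γ 1 1 ∈ p) fun q => γ 1 0 - γ 1 1 * (q.out : 𝓞 K) ∈ n * p := by
    rintro (- | q)
    · refine Iff.trans ?_ hnone
      rw [← mul_cuspMatrix_inv_apply γ s d hsd]
      rfl
    · simp only [Option.elim]
      rw [← mul_lowerUnipotent_inv_apply]
      rfl
  refine (existsUnique_congr hmem).mpr ?_
  by_cases h1 : γ 1 1 ∈ p
  · refine ⟨none, h1, ?_⟩
    rintro (- | q) hq
    · rfl
    · refine absurd h1 fun h1 => not_mem_lower_row γ hp.ne_top ?_ h1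
      have hq' : γ 1 0 - γ 1 1 * (q.out : 𝓞 K) ∈ p := Ideal.mul_le_right hq
      exact (Submodule.sub_mem_iff_left _ (p.mul_mem_right _ h1)).mp hq'
  · obtain ⟨q, hq, hu⟩ := existsUnique_quotient_sub_mul_mem hp hγ' h1
    refine ⟨some q, hq, ?_⟩
    rintro (- | q') hq'
    · exact absurd hq' h1
    · exact congrArg some (hu q' hq')

/-- The index of `Γ₀(𝔫)` in `Γ` is `ψ(𝔫)`. -/
theorem index_Gamma0 {n : Ideal (𝓞 K)} (hn : n ≠ 0) : ((Gamma0 n).index : ℚ) = psi n := by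
  induction n using UniqueFactorizationMonoid.induction_on_prime with
  | h₁ => exact absurd rfl hn
  | h₂ x hx =>
    have h1 : x = 1 := by simpa using hx
    have h2 : Gamma0 (1 : Ideal (𝓞 K)) = ⊤ := by
      ext γ
      simp [mem_Gamma0]
    rw [h1, psi_one, h2, Subgroup.index_top, Nat.cast_one]
  | h₃ n p hn0 hp ih =>
    rw [mul_comm]
    have hle : Gamma0 (n * p) ≤ Gamma0 n := fun γ hγ => Ideal.mul_le_left (mem_Gamma0.mp hγ)
    have hpm : p.IsMaximal := (Ideal.isPrime_of_prime hp).isMaximal hp.ne_zero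
    rw [← Subgroup.relIndex_mul_index hle, Nat.cast_mul, ih hn0]
    by_cases h : p ∣ n
    · rw [relIndex_Gamma0_mul_of_dvd hn0 hpm h, psi_mul_prime_of_dvd hn0 hp h, mul_comm]
    · rw [relIndex_Gamma0_mul_of_not_dvd hn0 hpm h, psi_mul_prime_of_not_dvd hn0 hp h, mul_comm]
      push_cast
      rfl

theorem psi_pos {n : Ideal (𝓞 K)} (hn : n ≠ 0) : 0 < psi n := by
  refine mul_pos (absNorm_pos hn) (Finset.prod_pos fun p _ => ?_)
  positivity

theorem IsUnimodularReps.finite {n : Ideal (𝓞 K)} (hn : n ≠ 0) {S : Set (GL (Fin 2) (𝓞 K))}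
    (hS : IsUnimodularReps n S) : S.Finite := by
  -- Infinite index is recorded as `0`, which `ψ(𝔫) > 0` excludes.
  have : (Gamma0 n).FiniteIndex := ⟨fun h => by
    have := index_Gamma0 hn
    rw [h, Nat.cast_zero] at this
    exact (psi_pos hn).ne this⟩
  exact hS.2.finite_right

theorem IsUnimodularReps.ncard {n : Ideal (𝓞 K)} (hn : n ≠ 0) {S : Set (GL (Fin 2) (𝓞 K))}
    (hS : IsUnimodularReps n S) : (S.ncard : ℚ) = psi n := by
  rw [hS.2.ncard_right, index_Gamma0 hn]

end Index

/-! ### Sublattices of `𝓞 K ⊕ 𝓞 K` as submodules of `R²`. -/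

section Lattices

variable {K : Type*} [Field K]

theorem isIdealPairMatrix_iff {c d : Ideal (𝓞 K)} {B : Matrix (Fin 2) (Fin 2) (𝓞 K)} :
    IsIdealPairMatrix c d B ↔ rowMap ⊤ B = pairSubmodule c d := by
  rw [← SetLike.coe_set_eq, rowMap, ← LinearMap.range_eq_map]
  rfl

variable [NumberField K]

variable (K) in
/-- The inclusion of `𝓞 K ⊕ 𝓞 K` in `(K ⊗ ℝ)²`. -/
def rowEmbedding : (Fin 2 → 𝓞 K) →ₗ[𝓞 K] RowSpace K :=
  (Algebra.linearMap (𝓞 K) (KHat K)).compLeft (Fin 2)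

theorem rowEmbedding_injective : Function.Injective (rowEmbedding K) := by
  intro v w h
  ext1 i
  have h1 : algebraMap K (KHat K) (algebraMap (𝓞 K) K (v i)) =
      algebraMap K (KHat K) (algebraMap (𝓞 K) K (w i)) := congrFun h i
  exact FaithfulSMul.algebraMap_injective (𝓞 K) K ((algebraMap K (KHat K)).injective h1)

theorem stdLattice_carrier : (stdLattice K).carrier = (⊤ : Submodule _ _).map (rowEmbedding K) :=
  LinearMap.range_eq_map _

theorem stdLattice_mulMat_carrier (g : Matrix (Fin 2) (Fin 2) (𝓞 K)) (hg : g.det ≠ 0) :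
    ((stdLattice K).mulMat g hg).carrier = (rowMap ⊤ g).map (rowEmbedding K) := by
  change (stdLattice K).carrier.map _ = _
  rw [stdLattice_carrier, rowMap, ← Submodule.map_comp, ← Submodule.map_comp]
  congr 1
  refine LinearMap.ext fun v => ?_
  funext j
  change ((rowEmbedding K v) ᵥ* ((toGLHat g hg : GL (Fin 2) (KHat K)) :
    Matrix (Fin 2) (Fin 2) (KHat K))) j = algebraMap (𝓞 K) (KHat K) ((v ᵥ* g) j)
  rw [Matrix.vecMul, Matrix.vecMul, dotProduct, dotProduct, map_sum]
  exact Finset.sum_congr rfl fun i _ => (map_mul (algebraMap (𝓞 K) (KHat K)) (v i) (g i j)).symm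

theorem idealMul_carrier_of_eq_map {a : Ideal (𝓞 K)} (ha : a ≠ ⊥) {L : OLattice K}
    {N : Submodule (𝓞 K) (Fin 2 → 𝓞 K)} (h : L.carrier = N.map (rowEmbedding K)) :
    (L.idealMul a ha).carrier = (a • N).map (rowEmbedding K) := by
  rw [Submodule.map_smul'', ← h]
  rfl

/-- A submodule of a lattice `L` which contains `𝔠 L` for a nonzero ideal `𝔠`, as a lattice. -/
def OLattice.ofLE (L : OLattice K) (N : Submodule (𝓞 K) (RowSpace K)) (hN : N ≤ L.carrier)
    (c : Ideal (𝓞 K)) (hc : c ≠ ⊥) (hcN : c • L.carrier ≤ N) : OLattice K where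
  carrier := N
  fg := by
    have : Module.Finite (𝓞 K) L.carrier := Module.Finite.iff_fg.mpr L.fg
    have : IsNoetherian (𝓞 K) L.carrier := isNoetherian_of_isNoetherianRing_of_finite _ _
    have h := (IsNoetherian.noetherian (N.submoduleOf L.carrier)).map L.carrier.subtype
    rwa [Submodule.submoduleOf, Submodule.map_comap_subtype, inf_eq_right.mpr hN] at h
  span_hat := by
    rw [eq_top_iff, ← (L.idealMul c hc).span_hat]
    exact Submodule.span_mono hcN
  finrank_span := by
    have h1 : Submodule.span K (N : Set (RowSpace K)) ≤ Submodule.span K L.carrier :=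
      Submodule.span_mono hN
    have h2 : Submodule.span K ((L.idealMul c hc).carrier : Set (RowSpace K)) ≤
        Submodule.span K N := Submodule.span_mono hcN
    have hL : Module.Finite K (Submodule.span K (L.carrier : Set (RowSpace K))) :=
      Module.finite_of_finrank_pos (by rw [L.finrank_span]; norm_num)
    have hN' : Module.Finite K (Submodule.span K (N : Set (RowSpace K))) :=
      Submodule.finiteDimensional_of_le h1
    apply le_antisymm
    · exact (Submodule.finrank_mono h1).trans L.finrank_span.le
    · exact (L.idealMul c hc).finrank_span.ge.trans (Submodule.finrank_mono h2)

theorem hasIndexIdeal_stdLattice_iff (M : OLattice K) (b : Ideal (𝓞 K)) :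
    HasIndexIdeal (stdLattice K) M b ↔
      ∃ N : Submodule (𝓞 K) (Fin 2 → 𝓞 K), M.carrier = N.map (rowEmbedding K) ∧
        ∃ c₁ c₂ : Ideal (𝓞 K), c₁ ∣ c₂ ∧ c₁ * c₂ = b ∧
          Nonempty (((Fin 2 → 𝓞 K) ⧸ N) ≃ₗ[𝓞 K] ((𝓞 K ⧸ c₁) × (𝓞 K ⧸ c₂))) := by
  have key : ∀ N : Submodule (𝓞 K) (Fin 2 → 𝓞 K), M.carrier = N.map (rowEmbedding K) →
      Nonempty (((Fin 2 → 𝓞 K) ⧸ N) ≃ₗ[𝓞 K]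
        ((stdLattice K).carrier ⧸ M.carrier.submoduleOf (stdLattice K).carrier)) := by
    intro N hN
    refine ⟨Submodule.Quotient.equiv N _
      (LinearEquiv.ofInjective (rowEmbedding K) rowEmbedding_injective) ?_⟩
    rw [hN]
    ext ⟨x, hx⟩
    constructor
    · rintro ⟨v, hv, hvx⟩
      exact ⟨v, hv, congrArg Subtype.val hvx⟩
    · rintro ⟨v, hv, hvx⟩
      exact ⟨v, hv, Subtype.ext hvx⟩
  constructor
  · rintro ⟨hle, c₁, c₂, hd, hm, ⟨e⟩⟩
    have hN : M.carrier = (M.carrier.comap (rowEmbedding K)).map (rowEmbedding K) := by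
      rw [Submodule.map_comap_eq, eq_comm, inf_eq_right]
      exact hle
    obtain ⟨e'⟩ := key _ hN
    exact ⟨_, hN, c₁, c₂, hd, hm, ⟨e'.trans e⟩⟩
  · rintro ⟨N, hN, c₁, c₂, hd, hm, ⟨e⟩⟩
    obtain ⟨e'⟩ := key _ hN
    refine ⟨?_, c₁, c₂, hd, hm, ⟨e'.symm.trans e⟩⟩
    rw [hN, stdLattice_carrier]
    exact Submodule.map_mono le_top

/-- Such a module contains `c R²`, hence has full rank. -/
theorem exists_carrier_eq_map_rowMap_pairSubmodule {c d : Ideal (𝓞 K)} (hc : c ≠ ⊥) (h : c ≤ d)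
    (C : GL (Fin 2) (𝓞 K)) :
    ∃ M : OLattice K, M.carrier = (rowMap (pairSubmodule c d) C).map (rowEmbedding K) := by
  refine ⟨(stdLattice K).ofLE _ ?_ c hc ?_, rfl⟩
  · rw [stdLattice_carrier]
    exact Submodule.map_mono le_top
  · rw [stdLattice_carrier, ← Submodule.map_smul'']
    refine Submodule.map_mono ?_
    rw [Submodule.smul_le]
    exact fun r hr v _ => (mem_iff_smul_mem_rowMap h C r).mp hr v

/-- The sublattices of `𝓞 K ⊕ 𝓞 K` of index `𝔟` are the lattices `(𝔟₁𝔟₂ ⊕ 𝔟₂) C`. -/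
theorem hasIndexIdeal_stdLattice_iff_exists {M : OLattice K} {b : Ideal (𝓞 K)} (hb : b ≠ ⊥) :
    HasIndexIdeal (stdLattice K) M b ↔ ∃ f ∈ factorizations b, ∃ C : GL (Fin 2) (𝓞 K),
      M.carrier = (rowMap (pairSubmodule (f.1 * f.2) f.2) C).map (rowEmbedding K) := by
  rw [hasIndexIdeal_stdLattice_iff]
  constructor
  · rintro ⟨N, hN, c₁, c₂, ⟨k, rfl⟩, rfl, ⟨e⟩⟩
    obtain ⟨C, hC⟩ := exists_rowMap_pairSubmodule_eq Ideal.mul_le_left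
      (right_ne_zero_of_mul hb) N e
    refine ⟨(k, c₁), ?_, C, ?_⟩
    · change k * c₁ ^ 2 = _
      ring
    · rw [hN, hC, mul_comm c₁ k]
  · rintro ⟨⟨k, c⟩, (rfl : k * c ^ 2 = b), C, hC⟩
    exact ⟨_, hC, c, k * c, dvd_mul_left _ _, by ring, nonempty_quotient_rowMap_equiv _ _ C⟩

end Lattices

/-! ### Parametrization by factorizations and cosets. -/

section Family

variable {K : Type*} [Field K] [NumberField K] {a b : Ideal (𝓞 K)} {β : 𝓞 K}
  {B : Ideal (𝓞 K) × Ideal (𝓞 K) → Matrix (Fin 2) (Fin 2) (𝓞 K)}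
  {S : Ideal (𝓞 K) × Ideal (𝓞 K) → Set (GL (Fin 2) (𝓞 K))}

theorem exists_isIdealPairMatrix (hβ0 : β ≠ 0) (hβ : a ^ 2 * b = Ideal.span {β})
    {f : Ideal (𝓞 K) × Ideal (𝓞 K)} (hf : f ∈ factorizations b) :
    ∃ B : Matrix (Fin 2) (Fin 2) (𝓞 K),
      IsIdealPairMatrix (a * f.1 * f.2) (a * f.2) B ∧ B.det = β := by
  simp_rw [isIdealPairMatrix_iff]
  refine exists_rowMap_top_eq_pairSubmodule hβ0 ?_
  rw [← hβ, ← (show f.1 * f.2 ^ 2 = b from hf)]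
  ring

/-- The lattice `(𝔞𝔟₁𝔟₂ ⊕ 𝔞𝔟₂) C` determines `(𝔟₁, 𝔟₂)` and the coset `Γ₀(𝔟₁) C`. -/
theorem eq_of_rowMap_eq (ha : a ≠ 0) (hb : b ≠ 0) {f f' : Ideal (𝓞 K) × Ideal (𝓞 K)}
    (hf : f ∈ factorizations b) (hf' : f' ∈ factorizations b)
    (hS : IsUnimodularReps f.1 (S f)) {C C' : GL (Fin 2) (𝓞 K)} (hC : C ∈ S f) (hC' : C' ∈ S f')
    (h : rowMap (pairSubmodule (a * f.1 * f.2) (a * f.2)) C =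
      rowMap (pairSubmodule (a * f'.1 * f'.2) (a * f'.2)) C') : f = f' ∧ C = C' := by
  obtain ⟨b₁, b₂⟩ := f
  obtain ⟨b₁', b₂'⟩ := f'
  change b₁ * b₂ ^ 2 = b at hf
  change b₁' * b₂' ^ 2 = b at hf'
  have h1 : b₁ ≠ 0 := left_ne_zero_of_mul (hf.trans_ne hb)
  have h2 : b₂ ≠ 0 := by
    rintro rfl
    exact hb (by rw [← hf, zero_pow two_ne_zero, mul_zero])
  simp only at h
  -- Regrouped as `𝔫𝔡 ⊕ 𝔡` with `𝔫 = 𝔟₁` and `𝔡 = 𝔞𝔟₂`, the shape whose stabilizer is `Γ₀(𝔟₁)`.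
  rw [mul_right_comm a b₁, mul_right_comm a b₁', mul_comm _ b₁, mul_comm _ b₁'] at h
  have hmul : b₁ * (a * b₂) * (a * b₂) = b₁' * (a * b₂') * (a * b₂') := by
    calc b₁ * (a * b₂) * (a * b₂) = a ^ 2 * (b₁ * b₂ ^ 2) := by ring
      _ = b₁' * (a * b₂') * (a * b₂') := by rw [hf, ← hf']; ring
  obtain ⟨e1, e2⟩ := eq_of_rowMap_pairSubmodule_eq Ideal.mul_le_right Ideal.mul_le_right hmul
    (mul_ne_zero h1 (mul_ne_zero ha h2)) h
  obtain rfl := mul_left_cancel₀ ha e2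
  obtain rfl := mul_right_cancel₀ (mul_ne_zero ha h2) e1
  rw [rowMap_pairSubmodule_eq_iff (mul_ne_zero ha h2)] at h
  refine ⟨rfl, ?_⟩
  obtain ⟨x, -, hx⟩ := Subgroup.isComplement_iff_existsUnique_mul_inv_mem.mp hS.2 C
  have e3 := hx ⟨C', hC'⟩ h
  have h1 : C * C⁻¹ ∈ Gamma0 b₁ := by
    rw [mul_inv_cancel]
    exact (Gamma0 b₁).one_mem
  have e4 := hx ⟨C, hC⟩ h1
  exact congrArg Subtype.val (e4.trans e3.symm)

/-- Every module `(𝔫𝔡 ⊕ 𝔡) C` is one with `C` a representative of a coset of `Γ₀(𝔫)`. -/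
theorem exists_mem_rowMap_pairSubmodule_eq {n d : Ideal (𝓞 K)} (hd : d ≠ ⊥)
    {T : Set (GL (Fin 2) (𝓞 K))} (hT : IsUnimodularReps n T) (C : GL (Fin 2) (𝓞 K)) :
    ∃ C' ∈ T, rowMap (pairSubmodule (n * d) d) C = rowMap (pairSubmodule (n * d) d) C' := by
  obtain ⟨⟨C', hC'⟩, h, -⟩ := Subgroup.isComplement_iff_existsUnique_mul_inv_mem.mp hT.2 C
  exact ⟨C', hC', (rowMap_pairSubmodule_eq_iff hd C C').mpr h⟩

theorem card_sigma_reps (hb : b ≠ 0) (hfin : ∀ f ∈ factorizations b, (S f).Finite)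
    (hS : ∀ f ∈ factorizations b, ((S f).ncard : ℚ) = psi f.1) :
    Nonempty (Fin (eta b) ≃ Σ f : factorizations b, S f) := by
  have h1 : Fintype (factorizations b) := (finite_factorizations hb).fintype
  have h2 : ∀ f : factorizations b, Finite (S f) := fun f => (hfin f f.2).to_subtype
  refine ⟨(Finite.equivFinOfCardEq ?_).symm⟩
  rw [Nat.card_sigma, ← Nat.cast_inj (R := ℚ), eta_eq_finsum_psi hb,
    ← finsum_mem_congr rfl hS, finsum_mem_eq_finite_toFinset_sum _ (finite_factorizations hb)]
  push_cast
  exact (Finset.sum_subtype _ (fun x => Set.Finite.mem_toFinset _)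
    fun f => ((S f).ncard : ℚ)).symm

end Family

end HeckeLattice

end

/-! ### Assembly of the lemma. -/

theorem mainTheorem10 {K : Type*} [Field K] [NumberField K]
    (a b : Ideal (NumberField.RingOfIntegers K)) (ha : a ≠ ⊥) (hb : b ≠ ⊥)
    (β : NumberField.RingOfIntegers K) (hβ : a ^ 2 * b = Ideal.span {β}) :
    -- the two expressions for the number of matrices
    ((HeckeLattice.eta b : ℚ) =
      ∑ᶠ f ∈ HeckeLattice.factorizations b, HeckeLattice.psi f.1) ∧
    -- matrices `B` and representatives `C` as required exist for each factorization
    (∀ f ∈ HeckeLattice.factorizations b,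
      (∃ B : Matrix (Fin 2) (Fin 2) (NumberField.RingOfIntegers K),
        HeckeLattice.IsIdealPairMatrix (a * f.1 * f.2) (a * f.2) B ∧ B.det = β) ∧
      (∃ S : Set (GL (Fin 2) (NumberField.RingOfIntegers K)),
        HeckeLattice.IsUnimodularReps f.1 S)) ∧
    -- every choice of them gives a family `g` with the required properties
    (∀ (B : Ideal (NumberField.RingOfIntegers K) × Ideal (NumberField.RingOfIntegers K) →
          Matrix (Fin 2) (Fin 2) (NumberField.RingOfIntegers K))
        (S : Ideal (NumberField.RingOfIntegers K) × Ideal (NumberField.RingOfIntegers K) →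
          Set (GL (Fin 2) (NumberField.RingOfIntegers K))),
      (∀ f ∈ HeckeLattice.factorizations b,
        HeckeLattice.IsIdealPairMatrix (a * f.1 * f.2) (a * f.2) (B f) ∧ (B f).det = β ∧
          HeckeLattice.IsUnimodularReps f.1 (S f)) →
      (∀ f ∈ HeckeLattice.factorizations b,
        (S f).Finite ∧ ((S f).ncard : ℚ) = HeckeLattice.psi f.1) ∧
      ∃ g : Fin (HeckeLattice.eta b) → Matrix (Fin 2) (Fin 2) (NumberField.RingOfIntegers K),
        Function.Injective g ∧
        Set.range g = {M | ∃ f ∈ HeckeLattice.factorizations b, ∃ C ∈ S f,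
          M = B f * (C : Matrix (Fin 2) (Fin 2) (NumberField.RingOfIntegers K))} ∧
        (∃ hg : ∀ i, (g i).det = β,
          HeckeLattice.dualTT a ha
              (HeckeLattice.dualT b (Finsupp.single (HeckeLattice.stdLattice K) (1 : ℚ))) =
            ((Ideal.absNorm a : ℚ) ^ 2 * (Ideal.absNorm b : ℚ)) •
              ∑ i, Finsupp.single
                ((HeckeLattice.stdLattice K).mulMat (g i)
                  ((hg i).trans_ne (HeckeLattice.generator_ne_zero ha hb hβ))) (1 : ℚ)) ∧
        -- right multiplication by each element of `Γ` permutes the cosets `Γ gᵢ`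
        (∀ γ : GL (Fin 2) (NumberField.RingOfIntegers K),
          ∃ σ : Equiv.Perm (Fin (HeckeLattice.eta b)), ∀ i,
            (Set.range fun δ : GL (Fin 2) (NumberField.RingOfIntegers K) =>
              (δ : Matrix (Fin 2) (Fin 2) (NumberField.RingOfIntegers K)) * g i * γ) =
            Set.range fun δ : GL (Fin 2) (NumberField.RingOfIntegers K) =>
              (δ : Matrix (Fin 2) (Fin 2) (NumberField.RingOfIntegers K)) * g (σ i))) := by
  have hβ0 := HeckeLattice.generator_ne_zero ha hb hβ
  refine ⟨HeckeLattice.eta_eq_finsum_psi hb, fun f hf =>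
    ⟨HeckeLattice.exists_isIdealPairMatrix hβ0 hβ hf, HeckeLattice.exists_isUnimodularReps f.1⟩,
    fun B S hBS => ?_⟩
  have hf0 : ∀ f ∈ HeckeLattice.factorizations b, f.1 ≠ 0 ∧ f.2 ≠ 0 := by
    rintro ⟨x, y⟩ (hf : x * y ^ 2 = b)
    exact ⟨left_ne_zero_of_mul (hf.trans_ne hb),
      fun hy => right_ne_zero_of_mul (hf.trans_ne hb) (by rw [show y = 0 from hy, zero_pow two_ne_zero])⟩
  have hfin : ∀ f ∈ HeckeLattice.factorizations b, (S f).Finite := fun f hf =>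
    (hBS f hf).2.2.finite (hf0 f hf).1
  have hcard : ∀ f ∈ HeckeLattice.factorizations b,
      ((S f).ncard : ℚ) = HeckeLattice.psi f.1 := fun f hf => (hBS f hf).2.2.ncard (hf0 f hf).1
  refine ⟨fun f hf => ⟨hfin f hf, hcard f hf⟩, ?_⟩
  obtain ⟨e⟩ := HeckeLattice.card_sigma_reps hb hfin hcard
  set g : Fin (HeckeLattice.eta b) → Matrix (Fin 2) (Fin 2) (𝓞 K) := fun i =>
    B (e i).1 * (((e i).2 : GL (Fin 2) (𝓞 K)) : Matrix (Fin 2) (Fin 2) (𝓞 K)) with hg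
  have hrow : ∀ i, HeckeLattice.rowMap ⊤ (g i) = HeckeLattice.rowMap (HeckeLattice.pairSubmodule
      (a * (e i).1.1.1 * (e i).1.1.2) (a * (e i).1.1.2)) ((e i).2 : GL (Fin 2) (𝓞 K)) := by
    intro i
    rw [hg, HeckeLattice.rowMap_mul,
      HeckeLattice.isIdealPairMatrix_iff.mp (hBS _ (e i).1.2).1]
  have hinj : ∀ i j, HeckeLattice.rowMap ⊤ (g i) = HeckeLattice.rowMap ⊤ (g j) → i = j := by
    intro i j h
    rw [hrow, hrow] at h
    obtain ⟨h1, h2⟩ := HeckeLattice.eq_of_rowMap_eq ha hb (e i).1.2 (e j).1.2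
      (hBS _ (e i).1.2).2.2 (e i).2.2 (e j).2.2 h
    apply e.injective
    generalize e i = x at h1 h2 ⊢
    generalize e j = y at h1 h2 ⊢
    obtain ⟨⟨f, hf⟩, C, hC⟩ := x
    obtain ⟨⟨f', hf'⟩, C', hC'⟩ := y
    simp only at h1 h2
    subst h1
    subst h2
    rfl
  have hdet : ∀ i, (g i).det = β := by
    intro i
    rw [hg, Matrix.det_mul, (hBS _ (e i).1.2).2.1, (hBS _ (e i).1.2).2.2.1 _ (e i).2.2, mul_one]
  refine ⟨g, fun i j h => hinj i j (congrArg _ h), ?_, ⟨hdet, ?_⟩, ?_⟩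
  · ext M
    constructor
    · rintro ⟨i, rfl⟩
      exact ⟨_, (e i).1.2, _, (e i).2.2, rfl⟩
    · rintro ⟨f, hf, C, hC, rfl⟩
      exact ⟨e.symm ⟨⟨f, hf⟩, ⟨C, hC⟩⟩, by rw [hg]; simp only; rw [Equiv.apply_symm_apply]⟩
  -- `M i` is the index `𝔟` sublattice whose multiple by `𝔞` is `(𝓞 K ⊕ 𝓞 K) gᵢ`. These enumerate
  -- the sublattices without repetition, which turns the sum over sublattices into a sum over `i`.
  · have hM : ∀ i, ∃ M : HeckeLattice.OLattice K, M.carrier = (HeckeLattice.rowMap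
        (HeckeLattice.pairSubmodule ((e i).1.1.1 * (e i).1.1.2) (e i).1.1.2)
        ((e i).2 : GL (Fin 2) (𝓞 K))).map (HeckeLattice.rowEmbedding K) := fun i =>
      HeckeLattice.exists_carrier_eq_map_rowMap_pairSubmodule
        (mul_ne_zero (hf0 _ (e i).1.2).1 (hf0 _ (e i).1.2).2) Ideal.mul_le_right _
    choose M hM using hM
    have haM : ∀ i, (M i).idealMul a ha =
        (HeckeLattice.stdLattice K).mulMat (g i) ((hdet i).trans_ne hβ0) := by
      intro i
      ext1
      rw [HeckeLattice.stdLattice_mulMat_carrier, hrow, mul_assoc,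
        ← HeckeLattice.smul_pairSubmodule, HeckeLattice.rowMap_smul]
      exact HeckeLattice.idealMul_carrier_of_eq_map ha (hM i)
    have hMinj : Function.Injective M := by
      intro i j h
      apply hinj
      apply Submodule.map_injective_of_injective HeckeLattice.rowEmbedding_injective
      rw [← HeckeLattice.stdLattice_mulMat_carrier _ ((hdet i).trans_ne hβ0),
        ← HeckeLattice.stdLattice_mulMat_carrier _ ((hdet j).trans_ne hβ0), ← haM, ← haM, h]
    have hset : {M | HeckeLattice.HasIndexIdeal (HeckeLattice.stdLattice K) M b} = Set.range M := by
      ext L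
      refine (HeckeLattice.hasIndexIdeal_stdLattice_iff_exists hb).trans ⟨?_, ?_⟩
      · rintro ⟨f, hf, C, hL⟩
        obtain ⟨C', hC', h⟩ := HeckeLattice.exists_mem_rowMap_pairSubmodule_eq (hf0 f hf).2
          (hBS f hf).2.2 C
        refine ⟨e.symm ⟨⟨f, hf⟩, ⟨C', hC'⟩⟩, ?_⟩
        ext1
        rw [hM, Equiv.apply_symm_apply, hL, h]
      · rintro ⟨i, rfl⟩
        exact ⟨_, (e i).1.2, _, hM i⟩
    rw [HeckeLattice.dualT, Finsupp.linearCombination_single, one_smul, hset,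
      finsum_mem_range hMinj, finsum_eq_sum_of_fintype, map_smul, map_sum, mul_comm, mul_smul,
      Finset.smul_sum (r := (Ideal.absNorm a : ℚ) ^ 2)]
    congr 1
    refine Finset.sum_congr rfl fun i _ => ?_
    rw [HeckeLattice.dualTT, Finsupp.linearCombination_single, one_smul, haM]
  · intro γ
    have hσ : ∀ i, ∃ j, HeckeLattice.rowMap ⊤ (g i * (γ : Matrix (Fin 2) (Fin 2) (𝓞 K))) =
        HeckeLattice.rowMap ⊤ (g j) := by
      intro i
      have hf := (e i).1.2
      obtain ⟨C', hC', h⟩ := HeckeLattice.exists_mem_rowMap_pairSubmodule_eq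
        (mul_ne_zero ha (hf0 _ hf).2) (hBS _ hf).2.2 (((e i).2 : GL (Fin 2) (𝓞 K)) * γ)
      refine ⟨e.symm ⟨(e i).1, ⟨C', hC'⟩⟩, ?_⟩
      rw [HeckeLattice.rowMap_mul, hrow, hrow, Equiv.apply_symm_apply,
        ← HeckeLattice.rowMap_mul, ← Units.val_mul, mul_comm a (e i).1.1.1, mul_assoc, h]
    choose σ hσ using hσ
    -- Right multiplication by `γ` is invertible on row modules, so `σ` is injective, hence
    -- bijective on a finite set.
    have hσinj : Function.Injective σ := by
      intro i j h
      apply hinj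
      have h1 := (hσ i).trans ((congrArg (fun k => HeckeLattice.rowMap ⊤ (g k)) h).trans (hσ j).symm)
      rw [HeckeLattice.rowMap_mul _ (g i), HeckeLattice.rowMap_mul _ (g j), HeckeLattice.rowMap_eq_iff,
        mul_inv_cancel, Units.val_one, HeckeLattice.rowMap_one] at h1
      exact h1
    refine ⟨Equiv.ofBijective σ (Finite.injective_iff_bijective.mp hσinj), fun i => ?_⟩
    have hγ : (g i * (γ : Matrix (Fin 2) (Fin 2) (𝓞 K))).det ≠ 0 := by
      rw [Matrix.det_mul, hdet]
      exact mul_ne_zero hβ0 (γ.isUnit.map Matrix.detMonoidHom).ne_zero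
    obtain ⟨δ₀, hδ₀⟩ := HeckeLattice.exists_mul_eq_of_rowMap_top_eq hγ (hσ i)
    rw [Equiv.ofBijective_apply, ← hδ₀]
    ext X
    constructor
    · rintro ⟨δ, rfl⟩
      refine ⟨δ * δ₀⁻¹, ?_⟩
      simp only
      rw [← mul_assoc, ← Units.val_mul, inv_mul_cancel_right, ← mul_assoc]
    · rintro ⟨δ, rfl⟩
      refine ⟨δ * δ₀, ?_⟩
      simp only [Units.val_mul, mul_assoc]
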